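/- Let $D=\,]-\tfrac12,\tfrac12[^2$ be split into the four quadrants $D_1=\,]-\tfrac12,0[^2$, $D_2=\,]0,\tfrac12[\times]-\tfrac12,0[$, $D_3=\,]-\tfrac12,0[\times]0,\tfrac12[$, $D_4=\,]0,\tfrac12[^2$. Let $V=H^1_0(D)$, $f\in V'$, $0<\theta<1$, $U=[-1,1]^4$, and $$a(x,y)=1-\theta\sum_{i=1}^4 y_i\,\chi_{D_i}(x).$$ For each $y\in U$ there is exactly one $u(y)\in V$ with $\int_D a(x,y)\,\nabla u(y)\cdot\nabla v\,dx=\langle f,v\rangle$ for all $v\in V$. The map $u$ is analytic at $y=0$. Let $t_\nu=\frac1{\nu!}\partial^\nu u(0)\in V$ be its Taylor coefficients and $u_k(y)=\sum_{|\nu|\le k}t_\nu y^\nu$. Then for every $k\in\mathbb{N}_0$, with $n(k):=8k+5$, there exist $v_1,\dots,v_{n(k)}\in V$ and polynomials $\phi_1,\dots,\phi_{n(k)}$ in four variables with real coefficients, each of total degree $k$ (for $k=0$: constants, possibly zero), such that $$u_k(y)=\sum_{\ell=1}^{n(k)}\phi_\ell(y)\,v_\ell\qquad\text{for all } y .$$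 Consequently, for every Borel probability measure $\mu$ on $U$ one has $u_k\in L^2(U,V,\mu)$ and $\operatorname{rank}(u_k)\le 8k+5$, where $\operatorname{rank}(w)$ is the dimension of the range of the operator $L^2(U,\mu)\to V$, $g\mapsto\int_U w(y)\,g(y)\,d\mu(y)$. -/

import Mathlib

open MeasureTheory Set
open scoped ContDiff Gradient

noncomputable section

/-- The plane `ℝ²` with its Euclidean structure. -/
abbrev Plane : Type := EuclideanSpace ℝ (Fin 2)

/-- `L²(Ω) × L²(Ω; ℝ²)`, with the Hilbert space norm `(‖u‖² + ‖g‖²)^(1/2)`.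
It contains the Sobolev space `H¹(Ω)` isometrically through `u ↦ (u, ∇u)`. -/
abbrev GraphSpace (Ω : Set Plane) : Type :=
  WithLp 2 (Lp ℝ 2 (volume.restrict Ω) × Lp Plane 2 (volume.restrict Ω))

/-- The pairs `(φ, ∇φ)` with `φ ∈ C_c^∞(Ω)`. -/
def testPairs (Ω : Set Plane) : Submodule ℝ (GraphSpace Ω) where
  carrier := {p | ∃ φ : Plane → ℝ, ContDiff ℝ ∞ φ ∧ HasCompactSupport φ ∧ tsupport φ ⊆ Ω ∧
    p.fst =ᵐ[volume.restrict Ω] φ ∧ p.snd =ᵐ[volume.restrict Ω] ∇ φ}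
  zero_mem' := by
    refine ⟨fun _ => 0, contDiff_const, HasCompactSupport.zero, by simp [tsupport], ?_, ?_⟩
    · exact Lp.coeFn_zero _ _ _
    · refine (Lp.coeFn_zero _ _ _).trans (Filter.Eventually.of_forall fun x => ?_)
      simp
  add_mem' := by
    rintro p q ⟨φ, hφ, hφc, hφs, hp1, hp2⟩ ⟨ψ, hψ, hψc, hψs, hq1, hq2⟩
    refine ⟨φ + ψ, hφ.add hψ, hφc.add hψc,
      (tsupport_add φ ψ).trans (union_subset hφs hψs), ?_, ?_⟩
    · exact (Lp.coeFn_add p.fst q.fst).trans (hp1.add hq1)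
    · refine (Lp.coeFn_add p.snd q.snd).trans ((hp2.add hq2).trans
        (Filter.Eventually.of_forall fun x => ?_))
      have h1 : DifferentiableAt ℝ φ x := (hφ.differentiable (by simp)) x
      have h2 : DifferentiableAt ℝ ψ x := (hψ.differentiable (by simp)) x
      simp [gradient, fderiv_add h1 h2]
  smul_mem' := by
    rintro c p ⟨φ, hφ, hφc, hφs, hp1, hp2⟩
    refine ⟨c • φ, hφ.const_smul c, hφc.smul_left (f := fun _ => c),
      (tsupport_smul_subset_right (fun _ => c) φ).trans hφs, ?_, ?_⟩
    · exact (Lp.coeFn_smul c p.fst).trans (hp1.const_smul c)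
    · refine (Lp.coeFn_smul c p.snd).trans ((hp2.const_smul c).trans
        (Filter.Eventually.of_forall fun x => ?_))
      have h1 : DifferentiableAt ℝ φ x := (hφ.differentiable (by simp)) x
      simp [gradient, fderiv_const_smul h1 c]

/-- `H¹₀(Ω)`: the closure of `C_c^∞(Ω)` in the `H¹`-norm. An element is stored together with its
weak gradient, as a limit of pairs `(φₙ, ∇φₙ)` in `L²(Ω) × L²(Ω; ℝ²)`. -/
def sobolevZero (Ω : Set Plane) : Submodule ℝ (GraphSpace Ω) :=
  (testPairs Ω).topologicalClosure

/-- The weak gradient of an element of `H¹₀(Ω)`. -/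
def weakGrad {Ω : Set Plane} (w : sobolevZero Ω) : Lp Plane 2 (volume.restrict Ω) :=
  (w : GraphSpace Ω).snd

/-- The product `I × J ⊆ ℝ²`. -/
def rect (I J : Set ℝ) : Set Plane := {x | x 0 ∈ I ∧ x 1 ∈ J}

/-- The unit square `D = ]-1/2, 1/2[²`. -/
def unitSquare : Set Plane := rect (Ioo (-1 / 2) (1 / 2)) (Ioo (-1 / 2) (1 / 2))

/-- The four open quadrants of the unit square. -/
def quadrant : Fin 4 → Set Plane :=
  ![rect (Ioo (-1 / 2) 0) (Ioo (-1 / 2) 0),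
    rect (Ioo 0 (1 / 2)) (Ioo (-1 / 2) 0),
    rect (Ioo (-1 / 2) 0) (Ioo 0 (1 / 2)),
    rect (Ioo 0 (1 / 2)) (Ioo 0 (1 / 2))]

/-- The solution space `V = H¹₀(D)`. -/
abbrev SolSpace : Type := sobolevZero unitSquare

/-- The parameter domain `U = [-1, 1]⁴`. -/
def paramCube : Set (Fin 4 → ℝ) := Icc (-1) 1

/-- The diffusion coefficient `a(x, y) = 1 - θ ∑ i, y i χ_{D i}(x)`. -/
def coeff (θ : ℝ) (y : Fin 4 → ℝ) (x : Plane) : ℝ :=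
  1 - θ * ∑ i, y i * (quadrant i).indicator 1 x

/-- `w ∈ V` is a weak solution of `-div (a(·, y) ∇ w) = f` in `D`, `w = 0` on `∂D`. -/
def IsWeakSolution (θ : ℝ) (f : SolSpace →L[ℝ] ℝ) (y : Fin 4 → ℝ) (w : SolSpace) : Prop :=
  ∀ v : SolSpace,
    ∫ x in unitSquare, coeff θ y x * inner ℝ (weakGrad w x) (weakGrad v x) = f v

/-- The Taylor coefficient `t_ν = (1 / ν!) ∂^ν u(0)`. The mixed partial derivative is the
derivative of order `|ν|` at `0`, applied to `ν i` copies of the unit vector `e i` for each `i`. -/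
def taylorCoeff {V : Type*} [NormedAddCommGroup V] [NormedSpace ℝ V] {d : ℕ}
    (u : (Fin d → ℝ) → V) (ν : Fin d → ℕ) : V :=
  ((∏ i, (ν i).factorial : ℕ) : ℝ)⁻¹ •
    iteratedFDeriv ℝ (∑ i, ν i) u 0 (fun j => Pi.single (finSigmaFinEquiv.symm j).1 1)

/-- The truncated power series `u_k(y) = ∑_{|ν| ≤ k} t_ν y^ν`, summed over `n = |ν| ≤ k`. -/
def taylorPartialSum {V : Type*} [NormedAddCommGroup V] [NormedSpace ℝ V] {d : ℕ}
    (u : (Fin d → ℝ) → V) (k : ℕ) (y : Fin d → ℝ) : V :=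
  ∑ n ∈ Finset.range (k + 1), ∑ ν ∈ Finset.piAntidiag Finset.univ n,
    (∏ i, y i ^ ν i) • taylorCoeff u ν

/-- The operator `M_u : L²(U, μ) → V`, `g ↦ ∫ g(y) u(y) dμ(y)`, for `u ∈ L²(U, V, μ)`. -/
def integralOperator {U V : Type*} [MeasurableSpace U] [NormedAddCommGroup V] [NormedSpace ℝ V]
    (μ : Measure U) (u : U → V) (hu : MemLp u 2 μ) : Lp ℝ 2 μ →ₗ[ℝ] V where
  toFun g := ∫ y, g y • u y ∂μ
  map_add' g h := by
    have hi : ∀ g : Lp ℝ 2 μ, Integrable (fun y => g y • u y) μ := fun g =>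
      memLp_one_iff_integrable.1 (hu.smul (Lp.memLp g))
    rw [← integral_add (hi g) (hi h)]
    refine integral_congr_ae ?_
    filter_upwards [Lp.coeFn_add g h] with y hy
    rw [hy, Pi.add_apply, add_smul]
  map_smul' c g := by
    rw [RingHom.id_apply, ← integral_smul]
    refine integral_congr_ae ?_
    filter_upwards [Lp.coeFn_smul c g] with y hy
    rw [hy, Pi.smul_apply, smul_assoc]

/-- `rank(u) = dim range(M_u)` with respect to the measure `μ`. -/
def separationRank {U V : Type*} [MeasurableSpace U] [NormedAddCommGroup V] [NormedSpace ℝ V]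
    (μ : Measure U) (u : U → V) (hu : MemLp u 2 μ) : Cardinal :=
  (integralOperator μ u hu).rank

end

noncomputable section

/-! Almost everywhere on the square, the indicator of each quadrant equals (1 ± sgn x₀)(1 ± sgn
x₁)/4. Let `S`, `T`, `R` represent, in the Dirichlet inner product, the forms ∫ σ ∇v·∇w with σ = sgn
x₀, sgn x₁, sgn x₀ sgn x₁. The weak equation becomes (1 - L y) u(y) = u(0), where L y is linear in y
and a combination of 1, `S`, `T`, `R`. By the Neumann series, the Taylor coefficients of order n are
combinations of words of length at most n in `S`, `T`, `R` applied to t = u(0)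
(`analyticAt_and_taylorCoeff_mem`). It remains to see that these exponentially many words span only
8n + 5 dimensions (`ParitySystem.exists_filtration`).

The collapse comes from parity. A function in H¹₀ that is odd in x_i vanishes on the axis x_i = 0,
so its product with sgn x_i stays in H¹₀ and has gradient sgn x_i ∇v (`signMul_mem_sobolevZero`). On
such functions `S` or `T` is a genuine multiplication, hence inverted by a second application.
Self-adjointness of the multiplications and the reflection symmetry of the square then give the
relations of `ParitySystem` (`SignedGradient.paritySystem`).

By `exists_splitting`, t = w + x + p + q. The part w is built from functions vanishing on both axes;
there `S` and `T` are commuting involutions, `R` is their product, and the orbit has dimension at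
most 4. The parts p and q are skeletal: odd in one variable only, and killed by the sign operator of
the other. For skeletal z, words of length at most n reduce to `R`^j z with j ≤ n and (`S` + `T`)
`R`^j z with j < n, which gives 2n + 1 dimensions. The even-even part x has `R` x = 0 and skeletal
images `S` x and `T` x, whose words are one letter shorter. For n ≥ 1 the count is 4 + 1 + 2(2n - 1)
+ 2(2n + 1) = 8n + 5.

The separated form follows from spanning vectors of this space, with an adjustment making every
degree exactly k (`exists_separated_form`). The rank bound holds since the integral operator takes
values in the span of the v_ℓ. -/

/-! ### Algebra: counting words in three operators subject to parity relations. -/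

/-- Three operators `S`, `T`, `R` on a space split into four parity classes `ee`, `oe`, `eo`, `oo`
(parity in the first, then in the second variable), with the relations satisfied by the energy
projections of the multiplications by `sgn x₀`, `sgn x₁` and `sgn x₀ sgn x₁`. -/
structure ParitySystem (V : Type*) [AddCommGroup V] [Module ℝ V] where
  S : Module.End ℝ V
  T : Module.End ℝ V
  R : Module.End ℝ V
  ee : Submodule ℝ V
  oe : Submodule ℝ V
  eo : Submodule ℝ V
  oo : Submodule ℝ V
  S_ee : ∀ {v}, v ∈ ee → S v ∈ oe
  S_oe : ∀ {v}, v ∈ oe → S v ∈ ee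
  S_eo : ∀ {v}, v ∈ eo → S v ∈ oo
  S_oo : ∀ {v}, v ∈ oo → S v ∈ eo
  T_ee : ∀ {v}, v ∈ ee → T v ∈ eo
  T_oe : ∀ {v}, v ∈ oe → T v ∈ oo
  T_eo : ∀ {v}, v ∈ eo → T v ∈ ee
  T_oo : ∀ {v}, v ∈ oo → T v ∈ oe
  SS_oe : ∀ {v}, v ∈ oe → S (S v) = v
  SS_oo : ∀ {v}, v ∈ oo → S (S v) = v
  TT_eo : ∀ {v}, v ∈ eo → T (T v) = v
  TT_oo : ∀ {v}, v ∈ oo → T (T v) = v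
  ST_ee : ∀ {v}, v ∈ ee → S (T v) = T (S v)
  ST_oo : ∀ {v}, v ∈ oo → S (T v) = T (S v)
  R_ee : ∀ {v}, v ∈ ee → R v = T (S v)
  R_oe : ∀ {v}, v ∈ oe → R v = T (S v)
  R_eo : ∀ {v}, v ∈ eo → R v = S (T v)
  R_oo : ∀ {v}, v ∈ oo → R v = T (S v)
  exists_add : ∀ v, ∃ x ∈ ee, ∃ p ∈ oe, ∃ q ∈ eo, ∃ o ∈ oo, v = x + p + q + o

namespace ParitySystem

variable {V : Type*} [AddCommGroup V] [Module ℝ V] (P : ParitySystem V)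

/-- The condition under which the orbit of `z` is controlled by the iterates of `R` alone. -/
def IsSkeletal (z : V) : Prop := (z ∈ P.oe ∧ P.T z = 0) ∨ (z ∈ P.eo ∧ P.S z = 0)

variable {P}

/-- `R` exchanges the two kinds: for z in `oe` with T z = 0, S(R z) = STS z = TSS z = T z = 0, where
the commutation is used at S z, which is even-even. -/
lemma IsSkeletal.R {z : V} (h : P.IsSkeletal z) : P.IsSkeletal (P.R z) := by
  rcases h with ⟨h, h0⟩ | ⟨h, h0⟩
  · right
    rw [P.R_oe h]
    exact ⟨P.T_ee (P.S_oe h), by rw [P.ST_ee (P.S_oe h), P.SS_oe h, h0]⟩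
  · left
    rw [P.R_eo h]
    exact ⟨P.S_ee (P.T_eo h), by rw [← P.ST_ee (P.T_eo h), P.TT_eo h, h0]⟩

lemma IsSkeletal.R_pow {z : V} (h : P.IsSkeletal z) (j : ℕ) : P.IsSkeletal ((P.R ^ j) z) := by
  induction j with
  | zero => exact h
  | succ j ih => rw [pow_succ']; exact ih.R

variable (P)

/-- The span of the words of length at most `n` in `S`, `T`, `R`, applied to a skeletal `z`. -/
def chain (n : ℕ) (z : V) : Submodule ℝ V :=
  Submodule.span ℝ (range fun j : Fin (n + 1) => (P.R ^ (j : ℕ)) z) ⊔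
    Submodule.span ℝ (range fun j : Fin n => (P.S + P.T) ((P.R ^ (j : ℕ)) z))

instance (n : ℕ) (z : V) : FiniteDimensional ℝ (P.chain n z) := by
  have := FiniteDimensional.span_of_finite ℝ
    (Set.finite_range fun j : Fin (n + 1) => (P.R ^ (j : ℕ)) z)
  have := FiniteDimensional.span_of_finite ℝ
    (Set.finite_range fun j : Fin n => (P.S + P.T) ((P.R ^ (j : ℕ)) z))
  unfold chain
  infer_instance

lemma finrank_chain_le (n : ℕ) (z : V) : Module.finrank ℝ (P.chain n z) ≤ 2 * n + 1 := by
  have := FiniteDimensional.span_of_finite ℝ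
    (Set.finite_range fun j : Fin (n + 1) => (P.R ^ (j : ℕ)) z)
  have := FiniteDimensional.span_of_finite ℝ
    (Set.finite_range fun j : Fin n => (P.S + P.T) ((P.R ^ (j : ℕ)) z))
  have h1 := finrank_range_le_card (R := ℝ) fun j : Fin (n + 1) => (P.R ^ (j : ℕ)) z
  have h2 := finrank_range_le_card (R := ℝ) fun j : Fin n => (P.S + P.T) ((P.R ^ (j : ℕ)) z)
  have h3 := Submodule.finrank_add_le_finrank_add_finrank
    (Submodule.span ℝ (range fun j : Fin (n + 1) => (P.R ^ (j : ℕ)) z))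
    (Submodule.span ℝ (range fun j : Fin n => (P.S + P.T) ((P.R ^ (j : ℕ)) z)))
  simp only [Set.finrank, Fintype.card_fin] at h1 h2
  unfold chain
  omega

lemma R_pow_mem_chain {j n : ℕ} (h : j ≤ n) (z : V) : (P.R ^ j) z ∈ P.chain n z :=
  Submodule.mem_sup_left (Submodule.subset_span ⟨⟨j, by omega⟩, rfl⟩)

lemma add_R_pow_mem_chain {j n : ℕ} (h : j < n) (z : V) :
    (P.S + P.T) ((P.R ^ j) z) ∈ P.chain n z :=
  Submodule.mem_sup_right (Submodule.subset_span ⟨⟨j, h⟩, rfl⟩)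

lemma self_mem_chain (n : ℕ) (z : V) : z ∈ P.chain n z := P.R_pow_mem_chain (Nat.zero_le n) z

lemma chain_mono (n : ℕ) (z : V) : P.chain n z ≤ P.chain (n + 1) z := by
  refine sup_le (Submodule.span_le.2 ?_) (Submodule.span_le.2 ?_)
  · rintro _ ⟨j, rfl⟩
    exact P.R_pow_mem_chain (by omega) z
  · rintro _ ⟨j, rfl⟩
    exact P.add_R_pow_mem_chain (by omega) z

variable {P}

lemma chain_le_comap {A : Module.End ℝ V} {n : ℕ} {z : V} {M : Submodule ℝ V}
    (h1 : ∀ j ≤ n, A ((P.R ^ j) z) ∈ M)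
    (h2 : ∀ j < n, A ((P.S + P.T) ((P.R ^ j) z)) ∈ M) : P.chain n z ≤ M.comap A := by
  refine sup_le (Submodule.span_le.2 ?_) (Submodule.span_le.2 ?_)
  · rintro _ ⟨j, rfl⟩
    exact h1 j (by omega)
  · rintro _ ⟨j, rfl⟩
    exact h2 j j.2

/-- Each `R`^j z is skeletal, so one of `S`, `T` kills it and `S` + `T` acts on it as the other. A
further letter either undoes that step, produces `R`^(j+1) z, or gives zero. -/
lemma IsSkeletal.chain_le_comap_S {z : V} (hz : P.IsSkeletal z) (n : ℕ) :
    P.chain n z ≤ (P.chain (n + 1) z).comap P.S := by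
  refine chain_le_comap (fun j hj => ?_) (fun j hj => ?_)
  · rcases hz.R_pow j with ⟨_, h⟩ | ⟨_, h⟩
    · simpa [h] using P.add_R_pow_mem_chain (show j < n + 1 by omega) z
    · simp [h]
  · rcases hz.R_pow j with ⟨h, h0⟩ | ⟨h, h0⟩
    · simpa [h0, P.SS_oe h] using P.R_pow_mem_chain (show j ≤ n + 1 by omega) z
    · have := P.R_pow_mem_chain (show j + 1 ≤ n + 1 by omega) z
      rw [pow_succ', Module.End.mul_apply, P.R_eo h] at this
      simpa [h0] using this

lemma IsSkeletal.chain_le_comap_T {z : V} (hz : P.IsSkeletal z) (n : ℕ) :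
    P.chain n z ≤ (P.chain (n + 1) z).comap P.T := by
  refine chain_le_comap (fun j hj => ?_) (fun j hj => ?_)
  · rcases hz.R_pow j with ⟨_, h⟩ | ⟨_, h⟩
    · simp [h]
    · simpa [h] using P.add_R_pow_mem_chain (show j < n + 1 by omega) z
  · rcases hz.R_pow j with ⟨h, h0⟩ | ⟨h, h0⟩
    · have := P.R_pow_mem_chain (show j + 1 ≤ n + 1 by omega) z
      rw [pow_succ', Module.End.mul_apply, P.R_oe h] at this
      simpa [h0] using this
    · simpa [h0, P.TT_eo h] using P.R_pow_mem_chain (show j ≤ n + 1 by omega) z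

lemma IsSkeletal.chain_le_comap_R {z : V} (hz : P.IsSkeletal z) (n : ℕ) :
    P.chain n z ≤ (P.chain (n + 1) z).comap P.R := by
  refine chain_le_comap (fun j hj => ?_) (fun j hj => ?_)
  · have := P.R_pow_mem_chain (show j + 1 ≤ n + 1 by omega) z
    rwa [pow_succ', Module.End.mul_apply] at this
  · rcases hz.R_pow j with ⟨h, h0⟩ | ⟨h, h0⟩
    · simp [h0, P.R_ee (P.S_oe h), P.SS_oe h]
    · simp [h0, P.R_ee (P.T_eo h), ← P.ST_ee (P.T_eo h), P.TT_eo h]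

variable (P)

/-- The vectors generated by `oo`, on which `S` and `T` are commuting involutions. -/
def IsInterior (w : V) : Prop :=
  ∃ a ∈ P.oo, ∃ b ∈ P.oo, ∃ c ∈ P.oo, ∃ d ∈ P.oo, w = P.T (P.S a) + P.T b + P.S c + d

variable {P}

lemma STS_oo {v : V} (h : v ∈ P.oo) : P.S (P.T (P.S v)) = P.T v := by
  rw [← P.ST_oo h, P.SS_oe (P.T_oo h)]

lemma TTS_oo {v : V} (h : v ∈ P.oo) : P.T (P.T (P.S v)) = P.S v := P.TT_eo (P.S_oo h)

/-- The four coordinates are permuted: `S` exchanges a with b and c with d, while `T` exchanges a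
with c and b with d. This is the regular action of the Klein four-group. -/
lemma IsInterior.S {w : V} (h : P.IsInterior w) : P.IsInterior (P.S w) := by
  obtain ⟨a, ha, b, hb, c, hc, d, hd, rfl⟩ := h
  refine ⟨b, hb, a, ha, d, hd, c, hc, ?_⟩
  simp only [map_add, STS_oo ha, P.ST_oo hb, P.SS_oo hc]
  abel

lemma IsInterior.T {w : V} (h : P.IsInterior w) : P.IsInterior (P.T w) := by
  obtain ⟨a, ha, b, hb, c, hc, d, hd, rfl⟩ := h
  refine ⟨c, hc, d, hd, a, ha, b, hb, ?_⟩
  simp only [map_add, TTS_oo ha, P.TT_oo hb]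
  abel

lemma IsInterior.S_S {w : V} (h : P.IsInterior w) : P.S (P.S w) = w := by
  obtain ⟨a, ha, b, hb, c, hc, d, hd, rfl⟩ := h
  simp only [map_add, STS_oo ha, P.SS_oe (P.T_oo hb), P.SS_oo hc, P.SS_oo hd, P.ST_oo ha]

lemma IsInterior.T_T {w : V} (h : P.IsInterior w) : P.T (P.T w) = w := by
  obtain ⟨a, ha, b, hb, c, hc, d, hd, rfl⟩ := h
  simp only [map_add, TTS_oo ha, P.TT_oo hb, TTS_oo hc, P.TT_oo hd]

lemma IsInterior.S_T {w : V} (h : P.IsInterior w) : P.S (P.T w) = P.T (P.S w) := by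
  obtain ⟨a, ha, b, hb, c, hc, d, hd, rfl⟩ := h
  simp only [map_add, TTS_oo ha, P.TT_oo hb, STS_oo ha, P.SS_oo ha, STS_oo hc, P.SS_oo hc,
    P.ST_oo hb, P.ST_oo hd, TTS_oo hb, P.TT_oo ha]

lemma IsInterior.R_eq {w : V} (h : P.IsInterior w) : P.R w = P.T (P.S w) := by
  obtain ⟨a, ha, b, hb, c, hc, d, hd, rfl⟩ := h
  simp only [map_add, P.R_ee (P.T_eo (P.S_oo ha)), P.R_oe (P.T_oo hb), P.R_eo (P.S_oo hc),
    P.R_oo hd, STS_oo hc, P.SS_oo hc]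

variable (P)

/-- The span of the orbit of an interior vector. -/
def interiorSpan (w : V) : Submodule ℝ V :=
  Submodule.span ℝ (range ![w, P.S w, P.T w, P.T (P.S w)])

instance (w : V) : FiniteDimensional ℝ (P.interiorSpan w) :=
  FiniteDimensional.span_of_finite ℝ (Set.finite_range _)

lemma finrank_interiorSpan_le (w : V) : Module.finrank ℝ (P.interiorSpan w) ≤ 4 := by
  exact (finrank_range_le_card (R := ℝ) ![w, P.S w, P.T w, P.T (P.S w)]).trans (by simp)

lemma mem_interiorSpan (w : V) (i : Fin 4) :
    ![w, P.S w, P.T w, P.T (P.S w)] i ∈ P.interiorSpan w :=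
  Submodule.subset_span ⟨i, rfl⟩

variable {P}

lemma IsInterior.interiorSpan_le_comap_S {w : V} (h : P.IsInterior w) :
    P.interiorSpan w ≤ (P.interiorSpan w).comap P.S := by
  refine Submodule.span_le.2 ?_
  rintro _ ⟨i, rfl⟩
  fin_cases i
  · simpa using P.mem_interiorSpan w 1
  · simpa [h.S_S] using P.mem_interiorSpan w 0
  · simpa [h.S_T] using P.mem_interiorSpan w 3
  · simpa [h.S.S_T, h.S_S] using P.mem_interiorSpan w 2

lemma IsInterior.interiorSpan_le_comap_T {w : V} (h : P.IsInterior w) :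
    P.interiorSpan w ≤ (P.interiorSpan w).comap P.T := by
  refine Submodule.span_le.2 ?_
  rintro _ ⟨i, rfl⟩
  fin_cases i
  · simpa using P.mem_interiorSpan w 2
  · simpa using P.mem_interiorSpan w 3
  · simpa [h.T_T] using P.mem_interiorSpan w 0
  · simpa [h.S.T_T] using P.mem_interiorSpan w 1

lemma IsInterior.interiorSpan_le_comap_R {w : V} (h : P.IsInterior w) :
    P.interiorSpan w ≤ (P.interiorSpan w).comap P.R := by
  refine Submodule.span_le.2 ?_
  rintro _ ⟨i, rfl⟩
  fin_cases i
  · simpa [h.R_eq] using P.mem_interiorSpan w 3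
  · simpa [h.S.R_eq, h.S_S] using P.mem_interiorSpan w 2
  · simpa [h.T.R_eq, h.S_T, h.S.T_T] using P.mem_interiorSpan w 1
  · simpa [h.S.T.R_eq, h.S.S_T, h.S_S, h.T_T] using P.mem_interiorSpan w 0

variable (P)

/-- Splitting of a vector into an interior part and three parts with short orbits. -/
lemma exists_splitting (t : V) : ∃ w x p q : V, t = w + x + p + q ∧ P.IsInterior w ∧
    P.R x = 0 ∧ P.IsSkeletal (P.S x) ∧ P.IsSkeletal (P.T x) ∧ P.IsSkeletal p ∧
    P.IsSkeletal q := by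
  obtain ⟨x, hx, p, hp, q, hq, o, ho, rfl⟩ := P.exists_add t
  -- On `oo` the word TS squares to the identity, and T and S separately do too. Subtracting TSTS x,
  -- TT p and SS q therefore removes the interior parts.
  have hx1 : P.T (P.S x) ∈ P.oo := P.T_oe (P.S_ee hx)
  have hx2 : x - P.T (P.S (P.T (P.S x))) ∈ P.ee :=
    sub_mem hx (P.T_eo (P.S_oo hx1))
  have hx3 : P.T (P.S (x - P.T (P.S (P.T (P.S x))))) = 0 := by
    rw [map_sub, map_sub, STS_oo hx1, P.TT_oo hx1, sub_self]
  refine ⟨P.T (P.S (P.T (P.S x))) + P.T (P.T p) + P.S (P.S q) + o,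
    x - P.T (P.S (P.T (P.S x))), p - P.T (P.T p), q - P.S (P.S q), by abel,
    ⟨_, hx1, _, P.T_oe hp, _, P.S_eo hq, _, ho, rfl⟩, ?_, Or.inl ⟨P.S_ee hx2, hx3⟩,
    Or.inr ⟨P.T_ee hx2, ?_⟩, Or.inl ⟨sub_mem hp (P.T_oo (P.T_oe hp)), ?_⟩,
    Or.inr ⟨sub_mem hq (P.S_oo (P.S_eo hq)), ?_⟩⟩
  · rw [P.R_ee hx2, hx3]
  · rw [P.ST_ee hx2, hx3]
  · rw [map_sub, P.TT_oo (P.T_oe hp), sub_self]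
  · rw [map_sub, P.SS_oo (P.S_eo hq), sub_self]

/-- The words of length at most `n` in `S`, `T`, `R` applied to one vector lie in a space of
dimension at most `8 n + 5`. -/
theorem exists_filtration (t : V) : ∃ F : ℕ → Submodule ℝ V, t ∈ F 0 ∧
    (∀ n, F n ≤ F (n + 1)) ∧ (∀ n, F n ≤ (F (n + 1)).comap P.S) ∧
    (∀ n, F n ≤ (F (n + 1)).comap P.T) ∧ (∀ n, F n ≤ (F (n + 1)).comap P.R) ∧
    ∀ n, FiniteDimensional ℝ (F n) ∧ Module.finrank ℝ (F n) ≤ 8 * n + 5 := by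
  obtain ⟨w, x, p, q, rfl, hw, hx, hSx, hTx, hp, hq⟩ := P.exists_splitting t
  -- `G n` is meant for words of length n + 1: the chains of p and q have full length, those of `S`
  -- x and `T` x are one shorter because a letter was spent in leaving x.
  let G : ℕ → Submodule ℝ V := fun n => P.interiorSpan w ⊔ (ℝ ∙ x) ⊔ P.chain n (P.S x) ⊔
    P.chain n (P.T x) ⊔ P.chain (n + 1) p ⊔ P.chain (n + 1) q
  have g1 : ∀ n, P.interiorSpan w ≤ G n := fun n => by
    simp only [G]; order
  have g2 : ∀ n, (ℝ ∙ x) ≤ G n := fun n => by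
    simp only [G]; order
  have g3 : ∀ n, P.chain n (P.S x) ≤ G n := fun n => by
    simp only [G]; order
  have g4 : ∀ n, P.chain n (P.T x) ≤ G n := fun n => by
    simp only [G]; order
  have g5 : ∀ n, P.chain (n + 1) p ≤ G n := fun n => by
    simp only [G]; order
  have g6 : ∀ n, P.chain (n + 1) q ≤ G n := fun n => by
    simp only [G]; order
  have hw0 : w ∈ P.interiorSpan w := P.mem_interiorSpan w 0
  have step : ∀ (A : Module.End ℝ V), P.interiorSpan w ≤ (P.interiorSpan w).comap A →
      (∀ n, A x ∈ G n) →
      (∀ z, P.IsSkeletal z → ∀ n, P.chain n z ≤ (P.chain (n + 1) z).comap A) →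
      (∀ n, G n ≤ (G (n + 1)).comap A) ∧ A (w + x + p + q) ∈ G 0 := by
    intro A h1 h2 h3
    refine ⟨fun n => ?_, ?_⟩
    · refine sup_le (sup_le (sup_le (sup_le (sup_le ?_ ?_) ?_) ?_) ?_) ?_
      · exact h1.trans (Submodule.comap_mono (g1 _))
      · rw [Submodule.span_singleton_le_iff_mem]
        exact h2 (n + 1)
      · exact (h3 _ hSx n).trans (Submodule.comap_mono (g3 _))
      · exact (h3 _ hTx n).trans (Submodule.comap_mono (g4 _))
      · exact (h3 _ hp _).trans (Submodule.comap_mono (g5 _))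
      · exact (h3 _ hq _).trans (Submodule.comap_mono (g6 _))
    · rw [map_add, map_add, map_add]
      refine add_mem (add_mem (add_mem ?_ (h2 0)) ?_) ?_
      · exact g1 0 (h1 hw0)
      · exact g5 0 (h3 p hp 0 (P.self_mem_chain 0 p))
      · exact g6 0 (h3 q hq 0 (P.self_mem_chain 0 q))
  -- The identity counts as a letter: it yields the monotonicity of `G` and t ∈ `G 0`.
  have h1 := step LinearMap.id le_rfl
    (fun n => g2 n (Submodule.mem_span_singleton_self x)) fun z _ n => P.chain_mono n z
  have hS := step P.S hw.interiorSpan_le_comap_S (fun n => g3 n (P.self_mem_chain n _))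
    fun z hz n => hz.chain_le_comap_S n
  have hT := step P.T hw.interiorSpan_le_comap_T (fun n => g4 n (P.self_mem_chain n _))
    fun z hz n => hz.chain_le_comap_T n
  have hR := step P.R hw.interiorSpan_le_comap_R (fun n => by simp [hx])
    fun z hz n => hz.chain_le_comap_R n
  -- At level 0 only the line through t is taken: adjoining w with its orbit, x, p and q separately
  -- could already cost 7 dimensions, more than the 5 allowed.
  refine ⟨fun n => Nat.casesOn n (ℝ ∙ (w + x + p + q)) G, Submodule.mem_span_singleton_self _,
    ?_, ?_, ?_, ?_, ?_⟩
  · rintro (_ | n)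
    · exact (Submodule.span_singleton_le_iff_mem _ _).2 h1.2
    · exact h1.1 n
  · rintro (_ | n)
    · exact (Submodule.span_singleton_le_iff_mem _ _).2 hS.2
    · exact hS.1 n
  · rintro (_ | n)
    · exact (Submodule.span_singleton_le_iff_mem _ _).2 hT.2
    · exact hT.1 n
  · rintro (_ | n)
    · exact (Submodule.span_singleton_le_iff_mem _ _).2 hR.2
    · exact hR.1 n
  · rintro (_ | n)
    · refine ⟨inferInstanceAs (FiniteDimensional ℝ (ℝ ∙ (w + x + p + q))), ?_⟩
      exact (finrank_span_le_card (R := ℝ) {w + x + p + q}).trans (by simp)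
    · refine ⟨inferInstanceAs (FiniteDimensional ℝ (G n)), ?_⟩
      -- The total is 4 + 1 + 2(2n + 1) + 2(2n + 3) = 8(n + 1) + 5.
      have e1 := P.finrank_interiorSpan_le w
      have e2 : Module.finrank ℝ (ℝ ∙ x) ≤ 1 := by
        simpa using finrank_span_le_card (R := ℝ) {x}
      have e3 := P.finrank_chain_le n (P.S x)
      have e4 := P.finrank_chain_le n (P.T x)
      have e5 := P.finrank_chain_le (n + 1) p
      have e6 := P.finrank_chain_le (n + 1) q
      have f1 := Submodule.finrank_add_le_finrank_add_finrank (P.interiorSpan w) (ℝ ∙ x)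
      have f2 := Submodule.finrank_add_le_finrank_add_finrank
        (P.interiorSpan w ⊔ (ℝ ∙ x)) (P.chain n (P.S x))
      have f3 := Submodule.finrank_add_le_finrank_add_finrank
        (P.interiorSpan w ⊔ (ℝ ∙ x) ⊔ P.chain n (P.S x)) (P.chain n (P.T x))
      have f4 := Submodule.finrank_add_le_finrank_add_finrank
        (P.interiorSpan w ⊔ (ℝ ∙ x) ⊔ P.chain n (P.S x) ⊔ P.chain n (P.T x)) (P.chain (n + 1) p)
      have f5 := Submodule.finrank_add_le_finrank_add_finrank
        (P.interiorSpan w ⊔ (ℝ ∙ x) ⊔ P.chain n (P.S x) ⊔ P.chain n (P.T x) ⊔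
          P.chain (n + 1) p) (P.chain (n + 1) q)
      change Module.finrank ℝ (G n) ≤ _
      simp only [G]
      omega

end ParitySystem

/-! ### Separated forms with polynomials of exact degree, and the rank bound. -/

/-- A finite-dimensional space of dimension at most `N` is spanned by `N` vectors, one of which
can be taken to be zero if the dimension is less than `N`. -/
lemma exists_spanning_family {V : Type*} [AddCommGroup V] [Module ℝ V] (F : Submodule ℝ V)
    [FiniteDimensional ℝ F] {N : ℕ} (hN : Module.finrank ℝ F ≤ N) :
    ∃ w : Fin N → V, F ≤ Submodule.span ℝ (range w) ∧
      (Module.finrank ℝ F < N → ∃ l, w l = 0) := by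
  let b := Module.finBasis ℝ F
  refine ⟨fun l => if h : (l : ℕ) < Module.finrank ℝ F then (b ⟨l, h⟩ : V) else 0, ?_, ?_⟩
  · intro x hx
    have h1 : x = ∑ i, b.repr ⟨x, hx⟩ i • (b i : V) :=
      calc x = ((∑ i, b.repr ⟨x, hx⟩ i • b i : F) : V) := by rw [b.sum_repr]
        _ = _ := by simp only [Submodule.coe_sum, Submodule.coe_smul]
    rw [h1]
    refine Submodule.sum_mem _ fun i _ => Submodule.smul_mem _ _ (Submodule.subset_span ?_)
    exact ⟨⟨i, i.2.trans_le hN⟩, by simp⟩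
  · intro h
    exact ⟨⟨_, h⟩, by simp⟩

/-- A polynomial with coefficients in a space of dimension at most `N` is a sum of `N` products
of a vector and a scalar polynomial of total degree exactly `k`. -/
lemma exists_separated_form {V : Type*} [AddCommGroup V] [Module ℝ V] {d N k : ℕ} (i₀ : Fin d)
    (F : Submodule ℝ V) [FiniteDimensional ℝ F] (c : (Fin d → ℕ) → V)
    (hc : ∀ ν, ∑ i, ν i ≤ k → c ν ∈ F) (hN : Module.finrank ℝ F ≤ N)
    (hk : Module.finrank ℝ F < N ∨ ∃ ν, ∑ i, ν i = k ∧ c ν ≠ 0) :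
    ∃ (v : Fin N → V) (φ : Fin N → MvPolynomial (Fin d) ℝ), (∀ l, (φ l).totalDegree = k) ∧
      ∀ y : Fin d → ℝ, ∑ n ∈ Finset.range (k + 1), ∑ ν ∈ Finset.piAntidiag Finset.univ n,
        (∏ i, y i ^ ν i) • c ν = ∑ l, MvPolynomial.eval y (φ l) • v l := by
  classical
  obtain ⟨w, hw, hw0⟩ := exists_spanning_family F hN
  have hsum : ∀ {n : ℕ} {ν : Fin d → ℕ}, ν ∈ Finset.piAntidiag Finset.univ n → ∑ i, ν i = n :=
    fun h => (Finset.mem_piAntidiag.1 h).1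
  have h1 : ∀ ν, ∃ a : Fin N → ℝ, ∑ i, ν i ≤ k → ∑ l, a l • w l = c ν := by
    intro ν
    by_cases h : ∑ i, ν i ≤ k
    · obtain ⟨a, ha⟩ := (Submodule.mem_span_range_iff_exists_fun ℝ).1 (hw (hc ν h))
      exact ⟨a, fun _ => ha⟩
    · exact ⟨0, fun h' => absurd h' h⟩
  choose a ha using h1
  let e : (Fin d → ℕ) → (Fin d →₀ ℕ) := Finsupp.equivFunOnFinite.symm
  have hedeg : ∀ ν, (e ν).sum (fun _ m => m) = ∑ i, ν i := fun ν => by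
    rw [Finsupp.sum_fintype _ _ (by simp)]; rfl
  let ψ : Fin N → MvPolynomial (Fin d) ℝ := fun l =>
    ∑ n ∈ Finset.range (k + 1), ∑ ν ∈ Finset.piAntidiag Finset.univ n,
      MvPolynomial.monomial (e ν) (a ν l)
  have hψdeg : ∀ l, (ψ l).totalDegree ≤ k := by
    intro l
    refine MvPolynomial.totalDegree_finsetSum_le fun n hn => ?_
    refine MvPolynomial.totalDegree_finsetSum_le fun ν hν => ?_
    refine ((MvPolynomial.totalDegree_monomial_le _ _).trans_eq (hedeg ν)).trans ?_
    have := hsum hν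
    have := Finset.mem_range.1 hn
    omega
  have hψeval : ∀ y : Fin d → ℝ, ∑ n ∈ Finset.range (k + 1),
      ∑ ν ∈ Finset.piAntidiag Finset.univ n, (∏ i, y i ^ ν i) • c ν =
        ∑ l, MvPolynomial.eval y (ψ l) • w l := by
    intro y
    have h2 : ∀ l, MvPolynomial.eval y (ψ l) = ∑ n ∈ Finset.range (k + 1),
        ∑ ν ∈ Finset.piAntidiag Finset.univ n, (∏ i, y i ^ ν i) * a ν l := by
      intro l
      simp only [ψ, map_sum, MvPolynomial.eval_monomial]
      refine Finset.sum_congr rfl fun n _ => Finset.sum_congr rfl fun ν _ => ?_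
      rw [Finsupp.prod_fintype _ _ (by simp), mul_comm]
      rfl
    simp only [h2, Finset.sum_smul]
    rw [Finset.sum_comm]
    refine Finset.sum_congr rfl fun n hn => ?_
    rw [Finset.sum_comm]
    refine Finset.sum_congr rfl fun ν hν => ?_
    have h3 := hsum hν
    have := Finset.mem_range.1 hn
    rw [← ha ν (by omega), Finset.smul_sum]
    exact Finset.sum_congr rfl fun l _ => by rw [mul_smul]
  -- One polynomial of degree exactly k is needed. If the dimension is below N, a zero vector is
  -- available and may carry X^k; otherwise a nonzero top coefficient `c ν` supplies the degree.
  have key : ∃ (l₀ : Fin N) (ψ' : Fin N → MvPolynomial (Fin d) ℝ),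
      (∀ l, (ψ' l).totalDegree ≤ k) ∧ (ψ' l₀).totalDegree = k ∧
      ∀ y, ∑ l, MvPolynomial.eval y (ψ l) • w l = ∑ l, MvPolynomial.eval y (ψ' l) • w l := by
    rcases hk with hk | ⟨ν, hν, hν0⟩
    · obtain ⟨l₀, hl₀⟩ := hw0 hk
      have hX : (MvPolynomial.X i₀ ^ k : MvPolynomial (Fin d) ℝ).totalDegree = k := by
        simp
      refine ⟨l₀, Function.update ψ l₀ (MvPolynomial.X i₀ ^ k), fun l => ?_, by simp, fun y => ?_⟩
      · by_cases h : l = l₀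
        · subst h; simp
        · simpa [h] using hψdeg l
      · refine Finset.sum_congr rfl fun l _ => ?_
        by_cases h : l = l₀
        · subst h; simp [hl₀]
        · simp [h]
    · have h3 : ∃ l, a ν l ≠ 0 := by
        by_contra! h
        exact hν0 (by rw [← ha ν hν.le]; simp [h])
      obtain ⟨l₀, hl₀⟩ := h3
      refine ⟨l₀, ψ, hψdeg, le_antisymm (hψdeg l₀) ?_, fun y => rfl⟩
      have h4 : MvPolynomial.coeff (e ν) (ψ l₀) = a ν l₀ := by
        simp only [ψ, MvPolynomial.coeff_sum, MvPolynomial.coeff_monomial]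
        rw [Finset.sum_eq_single k, Finset.sum_eq_single ν]
        · simp
        · intro ν' _ h
          rw [if_neg fun h' => h (Finsupp.equivFunOnFinite.symm.injective h')]
        · intro h
          exact absurd (Finset.mem_piAntidiag.2 ⟨hν, by simp⟩) h
        · intro n _ hn
          refine Finset.sum_eq_zero fun ν' hν' => ?_
          rw [if_neg]
          intro h'
          have h5 : ν' = ν := Finsupp.equivFunOnFinite.symm.injective h'
          subst h5
          exact hn ((hsum hν').symm.trans hν)
        · simp
      rw [← hν, ← hedeg]
      exact MvPolynomial.le_totalDegree (MvPolynomial.mem_support_iff.2 (by rwa [h4]))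
  obtain ⟨l₀, ψ', hdeg, hl₀, hsame⟩ := key
  -- Adding ψ' l₀ to every polynomial of degree below k raises its degree to k; subtracting the
  -- corresponding vectors from w l₀ leaves the sum unchanged.
  let B : Finset (Fin N) := Finset.univ.filter fun l => (ψ' l).totalDegree < k
  have hl₀B : l₀ ∉ B := by simp [B, hl₀]
  refine ⟨fun l => if l = l₀ then w l₀ - ∑ j ∈ B, w j else w l,
    fun l => if (ψ' l).totalDegree < k then ψ' l + ψ' l₀ else ψ' l, fun l => ?_, fun y => ?_⟩
  · beta_reduce
    split_ifs with h
    · rw [MvPolynomial.totalDegree_add_eq_right_of_totalDegree_lt (by rwa [hl₀]), hl₀]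
    · exact le_antisymm (hdeg l) (not_lt.1 h)
  · rw [hψeval, hsame]
    have h5 : ∀ l, MvPolynomial.eval y (if (ψ' l).totalDegree < k then ψ' l + ψ' l₀ else ψ' l) •
        (if l = l₀ then w l₀ - ∑ j ∈ B, w j else w l) = MvPolynomial.eval y (ψ' l) • w l +
          ((if l ∈ B then MvPolynomial.eval y (ψ' l₀) • w l else 0) -
            if l = l₀ then MvPolynomial.eval y (ψ' l₀) • ∑ j ∈ B, w j else 0) := by
      intro l
      by_cases hl : l = l₀
      · subst hl
        simp [hl₀, hl₀B, sub_eq_add_neg]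
      · by_cases hB : (ψ' l).totalDegree < k
        · simp [hl, hB, B, add_smul]
        · simp [hl, hB, B]
    simp only [h5, Finset.sum_add_distrib, Finset.sum_sub_distrib, Finset.sum_ite_mem,
      Finset.univ_inter, Finset.sum_ite_eq', Finset.mem_univ, if_true, Finset.smul_sum, sub_self,
      add_zero]

/-- If all coefficients of order k vanish, the partial sum lives one level lower (in the zero space
when k = 0). Since `N` is strictly increasing with `N 0` positive, this leaves the spare vector
needed for exact degree k. -/
lemma exists_separated_form_of_filtration {V : Type*} [AddCommGroup V] [Module ℝ V] {d : ℕ}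
    (i₀ : Fin d) (F : ℕ → Submodule ℝ V) (hmono : Monotone F) {N : ℕ → ℕ} (hN0 : 0 < N 0)
    (hN : StrictMono N) (hF : ∀ n, FiniteDimensional ℝ (F n) ∧ Module.finrank ℝ (F n) ≤ N n)
    (c : (Fin d → ℕ) → V) (hc : ∀ ν, c ν ∈ F (∑ i, ν i)) (k : ℕ) :
    ∃ (v : Fin (N k) → V) (φ : Fin (N k) → MvPolynomial (Fin d) ℝ),
      (∀ l, (φ l).totalDegree = k) ∧
      ∀ y : Fin d → ℝ, ∑ n ∈ Finset.range (k + 1), ∑ ν ∈ Finset.piAntidiag Finset.univ n,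
        (∏ i, y i ^ ν i) • c ν = ∑ l, MvPolynomial.eval y (φ l) • v l := by
  by_cases h : ∃ ν, ∑ i, ν i = k ∧ c ν ≠ 0
  · have := (hF k).1
    exact exists_separated_form i₀ (F k) c (fun ν hν => hmono hν (hc ν)) (hF k).2 (Or.inr h)
  · push Not at h
    cases k with
    | zero =>
      refine exists_separated_form i₀ ⊥ c (fun ν hν => ?_) (by simp) (Or.inl (by simpa))
      rw [Submodule.mem_bot]
      exact h ν (Nat.le_zero.1 hν)
    | succ k =>
      have := (hF k).1
      have hlt := (hF k).2.trans_lt (hN (Nat.lt_succ_self k))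
      refine exists_separated_form i₀ (F k) c (fun ν hν => ?_) hlt.le (Or.inl hlt)
      rcases hν.lt_or_eq with h1 | h1
      · exact hmono (Nat.lt_succ_iff.1 h1) (hc ν)
      · rw [h ν h1]
        exact zero_mem _

lemma memLp_of_continuous {X E : Type*} [TopologicalSpace X] [CompactSpace X]
    [SecondCountableTopology X] [MeasurableSpace X] [BorelSpace X] [NormedAddCommGroup E]
    {p : ENNReal} {μ : Measure X} [IsFiniteMeasure μ] {g : X → E} (hg : Continuous g) :
    MemLp g p μ := by
  obtain ⟨C, hC⟩ := (isCompact_range hg).isBounded.exists_norm_le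
  exact MemLp.of_bound hg.aestronglyMeasurable C
    (Filter.Eventually.of_forall fun y => hC _ ⟨y, rfl⟩)

/-- A sum of `N` products of a polynomial and a vector has rank at most `N`. -/
lemma exists_memLp_separationRank_le {V : Type*} [NormedAddCommGroup V] [NormedSpace ℝ V]
    [CompleteSpace V] {d N : ℕ} {K : Set (Fin d → ℝ)} (hK : IsCompact K) (w : (Fin d → ℝ) → V)
    (v : Fin N → V) (φ : Fin N → MvPolynomial (Fin d) ℝ)
    (hw : ∀ y, w y = ∑ l, MvPolynomial.eval y (φ l) • v l) (μ : Measure K) [IsFiniteMeasure μ] :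
    ∃ hu : MemLp (fun y : K => w y) 2 μ,
      separationRank μ (fun y : K => w y) hu ≤ (N : Cardinal) := by
  have : CompactSpace K := isCompact_iff_compactSpace.1 hK
  have hcont : ∀ l, Continuous fun y : K => MvPolynomial.eval (y : Fin d → ℝ) (φ l) := fun l =>
    (MvPolynomial.continuous_eval _).comp continuous_subtype_val
  have hu : MemLp (fun y : K => w y) 2 μ := by
    simp only [hw]
    exact memLp_of_continuous
      (continuous_finsetSum _ fun l _ => (hcont l).smul continuous_const)
  refine ⟨hu, ?_⟩
  have hrange : LinearMap.range (integralOperator μ _ hu) ≤ Submodule.span ℝ (range v) := by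
    rintro _ ⟨g, rfl⟩
    have h1 : ∀ l, Integrable (fun y : K => g y * MvPolynomial.eval (y : Fin d → ℝ) (φ l)) μ :=
      fun l => memLp_one_iff_integrable.1
        ((memLp_of_continuous (p := 2) (hcont l)).smul (Lp.memLp g))
    have h2 : integralOperator μ _ hu g =
        ∑ l, (∫ y : K, g y * MvPolynomial.eval (y : Fin d → ℝ) (φ l) ∂μ) • v l := by
      change ∫ y : K, g y • w y ∂μ = _
      simp only [hw, Finset.smul_sum, smul_smul]
      rw [integral_finsetSum _ fun l _ => (h1 l).smul_const (v l)]
      exact Finset.sum_congr rfl fun l _ => integral_smul_const _ _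
    rw [h2]
    exact Submodule.sum_mem _ fun l _ =>
      Submodule.smul_mem _ _ (Submodule.subset_span ⟨l, rfl⟩)
  have := FiniteDimensional.span_of_finite ℝ (Set.finite_range v)
  refine (Submodule.rank_mono hrange).trans ?_
  rw [← Module.finrank_eq_rank]
  have h3 := finrank_range_le_card (R := ℝ) v
  rw [Fintype.card_fin] at h3
  exact_mod_cast h3

/-! ### Taylor coefficients of a Neumann series. -/

/-- Near `0` the map `y ↦ (1 - L y)⁻¹ t` is analytic, and its Taylor coefficients of order `n` are
combinations of products of `n` of the operators `L y`, applied to `t`. -/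
lemma analyticAt_and_taylorCoeff_mem {V : Type*} [NormedAddCommGroup V] [NormedSpace ℝ V]
    [CompleteSpace V] {d : ℕ} (L : (Fin d → ℝ) →L[ℝ] V →L[ℝ] V) (t : V)
    (u : (Fin d → ℝ) → V) (hu : ∀ᶠ y in nhds 0, u y = Ring.inverse (1 - L y) t)
    (F : ℕ → Submodule ℝ V) (ht : t ∈ F 0) (hF : ∀ n y, ∀ v ∈ F n, L y v ∈ F (n + 1)) :
    AnalyticAt ℝ u 0 ∧ ∀ ν : Fin d → ℕ, taylorCoeff u ν ∈ F (∑ i, ν i) := by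
  have h0 := hasFPowerSeriesOnBall_inverse_one_sub ℝ (V →L[ℝ] V)
  rw [← map_zero L] at h0
  have h1 := (ContinuousLinearMap.apply ℝ V t).comp_hasFPowerSeriesOnBall
    h0.compContinuousLinearMap
  have h2 : HasFPowerSeriesAt u _ 0 :=
    HasFPowerSeriesAt.congr ⟨_, h1⟩ (hu.mono fun y hy => hy.symm)
  refine ⟨h2.analyticAt, fun ν => ?_⟩
  obtain ⟨r, hr⟩ := h2
  have hword : ∀ (n : ℕ) (v : Fin n → (Fin d → ℝ)),
      (List.ofFn fun i => L (v i)).prod t ∈ F n := by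
    intro n
    induction n with
    | zero => intro v; simpa using ht
    | succ n ih =>
      intro v
      rw [List.ofFn_succ, List.prod_cons]
      exact hF n _ _ (ih _)
  -- The n-th derivative is the sum, over permutations of its arguments, of the n-th term of the
  -- series; each summand is a word of length n applied to t.
  rw [taylorCoeff, hr.iteratedFDeriv_eq_sum_of_completeSpace]
  refine Submodule.smul_mem _ _ (Submodule.sum_mem _ fun σ _ => ?_)
  exact hword _ _

/-! ### Coordinate signs and reflections, acting on the square and on L². -/

/-- The sign of the `i`-th coordinate (with value `-1` at zero). -/
def signAt (i : Fin 2) (x : Plane) : ℝ := if 0 < x i then 1 else -1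

lemma signAt_mul_self (i : Fin 2) (x : Plane) : signAt i x * signAt i x = 1 := by
  unfold signAt; split_ifs <;> norm_num

lemma abs_signAt (i : Fin 2) (x : Plane) : |signAt i x| = 1 := by
  unfold signAt; split_ifs <;> norm_num

lemma measurable_signAt (i : Fin 2) : Measurable (signAt i) :=
  Measurable.ite (measurableSet_lt measurable_const (by fun_prop)) measurable_const
    measurable_const

/-- The reflection of the plane which changes the sign of the `i`-th coordinate. -/
def coordFlip (i : Fin 2) : Plane ≃ₗᵢ[ℝ] Plane :=
  LinearIsometryEquiv.piLpCongrRight 2 fun j =>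
    if j = i then LinearIsometryEquiv.neg ℝ else LinearIsometryEquiv.refl ℝ ℝ

@[simp]
lemma coordFlip_apply (i : Fin 2) (x : Plane) (j : Fin 2) :
    coordFlip i x j = if j = i then -x j else x j := by
  unfold coordFlip
  rw [LinearIsometryEquiv.piLpCongrRight_apply]
  by_cases h : j = i <;> simp [h]

@[simp]
lemma coordFlip_coordFlip (i : Fin 2) (x : Plane) : coordFlip i (coordFlip i x) = x := by
  ext j
  by_cases h : j = i <;> simp [h]

lemma coordFlip_comm (i j : Fin 2) (x : Plane) :
    coordFlip i (coordFlip j x) = coordFlip j (coordFlip i x) := by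
  ext k
  simp only [coordFlip_apply]
  split_ifs <;> rfl

lemma inner_coordFlip_left (i : Fin 2) (x y : Plane) :
    inner ℝ (coordFlip i x) y = inner ℝ x (coordFlip i y) := by
  rw [← LinearIsometryEquiv.inner_map_map (coordFlip i) x, coordFlip_coordFlip]

lemma norm_sub_coordFlip (i : Fin 2) (x : Plane) : ‖x - coordFlip i x‖ = 2 * |x i| := by
  have h : x - coordFlip i x = EuclideanSpace.single i (2 * x i) := by
    ext j
    by_cases h : j = i
    · subst h; simp; ring
    · simp [h]
  rw [h, PiLp.norm_single, Real.norm_eq_abs, abs_mul, abs_two]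

lemma ae_coord_ne_zero (i : Fin 2) : ∀ᵐ x : Plane, x i ≠ 0 := by
  have h := Measure.addHaar_submodule (volume : Measure Plane)
    (LinearMap.ker (EuclideanSpace.projₗ i : Plane →ₗ[ℝ] ℝ)) (by
      intro h
      have h1 : (EuclideanSpace.single i (1 : ℝ) : Plane) ∈
          LinearMap.ker (EuclideanSpace.projₗ i : Plane →ₗ[ℝ] ℝ) := by rw [h]; trivial
      simp at h1)
  rw [ae_iff]
  convert h using 2
  ext x
  simp

lemma signAt_coordFlip_of_ne {i j : Fin 2} (h : j ≠ i) (x : Plane) :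
    signAt j (coordFlip i x) = signAt j x := by simp [signAt, h]

lemma signAt_coordFlip_self {i : Fin 2} {x : Plane} (h : x i ≠ 0) :
    signAt i (coordFlip i x) = -signAt i x := by
  rcases h.lt_or_gt with h | h
  · simp [signAt, h, h.not_gt]
  · simp [signAt, h, h.le]

lemma coordFlip_mem_unitSquare (i : Fin 2) (x : Plane) :
    coordFlip i x ∈ unitSquare ↔ x ∈ unitSquare := by
  have key : ∀ t : ℝ, -t ∈ Ioo (-1 / 2 : ℝ) (1 / 2) ↔ t ∈ Ioo (-1 / 2 : ℝ) (1 / 2) := fun t =>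
    ⟨fun h => ⟨by linarith [h.2], by linarith [h.1]⟩,
      fun h => ⟨by linarith [h.2], by linarith [h.1]⟩⟩
  fin_cases i
  · exact and_congr (by simpa using key (x 0)) (by simp)
  · exact and_congr (by simp) (by simpa using key (x 1))

lemma measurePreserving_coordFlip (i : Fin 2) :
    MeasurePreserving (coordFlip i) (volume.restrict unitSquare) (volume.restrict unitSquare) := by
  have h : coordFlip i ⁻¹' unitSquare = unitSquare := by
    ext x; exact coordFlip_mem_unitSquare i x
  have h1 := (coordFlip i).measurePreserving.restrict_preimage_emb
    (coordFlip i).toHomeomorph.measurableEmbedding unitSquare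
  rwa [h] at h1

lemma isOpen_unitSquare : IsOpen unitSquare :=
  (isOpen_Ioo.preimage (by fun_prop : Continuous fun x : Plane => x 0)).inter
    (isOpen_Ioo.preimage (by fun_prop : Continuous fun x : Plane => x 1))

lemma isBounded_unitSquare : Bornology.IsBounded unitSquare := by
  refine isBounded_iff_forall_norm_le.2 ⟨1, fun x hx => ?_⟩
  obtain ⟨⟨h1, h2⟩, h3, h4⟩ := hx
  rw [EuclideanSpace.norm_eq, Real.sqrt_le_iff, Fin.sum_univ_two, Real.norm_eq_abs,
    Real.norm_eq_abs, sq_abs, sq_abs]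
  exact ⟨zero_le_one, by nlinarith⟩

instance : IsFiniteMeasure ((volume : Measure Plane).restrict unitSquare) :=
  ⟨by rw [Measure.restrict_apply_univ]; exact isBounded_unitSquare.measure_lt_top⟩

section SignMul

variable {E : Type*} [NormedAddCommGroup E] [NormedSpace ℝ E] {μ : Measure Plane}

lemma memLp_signAt_smul (i : Fin 2) (u : Lp E 2 μ) : MemLp (fun x => signAt i x • u x) 2 μ :=
  (Lp.memLp u).of_le ((measurable_signAt i).aestronglyMeasurable.smul (Lp.aestronglyMeasurable u))
    (Filter.Eventually.of_forall fun x => by rw [norm_smul, Real.norm_eq_abs, abs_signAt, one_mul])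

/-- Multiplication by the sign of the `i`-th coordinate. -/
def signMul (i : Fin 2) : Lp E 2 μ →L[ℝ] Lp E 2 μ :=
  LinearMap.mkContinuous
    { toFun := fun u => (memLp_signAt_smul i u).toLp _
      map_add' := fun u v => by
        rw [← MemLp.toLp_add, MemLp.toLp_eq_toLp_iff]
        filter_upwards [Lp.coeFn_add u v] with x hx
        rw [hx, Pi.add_apply, Pi.add_apply, smul_add]
      map_smul' := fun c u => by
        rw [← MemLp.toLp_const_smul, MemLp.toLp_eq_toLp_iff]
        filter_upwards [Lp.coeFn_smul c u] with x hx
        rw [hx, Pi.smul_apply, Pi.smul_apply, smul_comm, RingHom.id_apply] }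
    1 fun u => by
      rw [one_mul]
      refine Lp.norm_le_norm_of_ae_le ?_
      filter_upwards [(memLp_signAt_smul i u).coeFn_toLp] with x hx
      change ‖(memLp_signAt_smul i u).toLp _ x‖ ≤ _
      rw [hx, norm_smul, Real.norm_eq_abs, abs_signAt, one_mul]

lemma coeFn_signMul (i : Fin 2) (u : Lp E 2 μ) :
    signMul i u =ᵐ[μ] fun x => signAt i x • u x :=
  (memLp_signAt_smul i u).coeFn_toLp

@[simp]
lemma signMul_signMul (i : Fin 2) (u : Lp E 2 μ) : signMul i (signMul i u) = u := by
  refine Lp.ext ?_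
  filter_upwards [coeFn_signMul i (signMul i u), coeFn_signMul i u] with x h1 h2
  rw [h1, h2, smul_smul, signAt_mul_self, one_smul]

lemma signMul_comm (i j : Fin 2) (u : Lp E 2 μ) :
    signMul i (signMul j u) = signMul j (signMul i u) := by
  refine Lp.ext ?_
  filter_upwards [coeFn_signMul i (signMul j u), coeFn_signMul j u,
    coeFn_signMul j (signMul i u), coeFn_signMul i u] with x h1 h2 h3 h4
  rw [h1, h2, h3, h4, smul_comm]

end SignMul

lemma inner_signMul_left {E : Type*} [NormedAddCommGroup E] [InnerProductSpace ℝ E]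
    {μ : Measure Plane} (i : Fin 2) (u v : Lp E 2 μ) :
    inner ℝ (signMul i u) v = inner ℝ u (signMul i v) := by
  rw [L2.inner_def, L2.inner_def]
  refine integral_congr_ae ?_
  filter_upwards [coeFn_signMul i u, coeFn_signMul i v] with x h1 h2
  rw [h1, h2, real_inner_smul_left, real_inner_smul_right]

/-- The reflection of a function on the unit square. -/
def flipFun (i : Fin 2) : Lp ℝ 2 (volume.restrict unitSquare) →L[ℝ]
    Lp ℝ 2 (volume.restrict unitSquare) :=
  (Lp.compMeasurePreservingₗᵢ ℝ _ (measurePreserving_coordFlip i)).toContinuousLinearMap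

lemma coeFn_flipFun (i : Fin 2) (u : Lp ℝ 2 (volume.restrict unitSquare)) :
    flipFun i u =ᵐ[volume.restrict unitSquare] fun x => u (coordFlip i x) :=
  Lp.coeFn_compMeasurePreserving u (measurePreserving_coordFlip i)

/-- The reflection of a vector field on the unit square: the action on gradients of the
reflection of functions. -/
def flipField (i : Fin 2) : Lp Plane 2 (volume.restrict unitSquare) →L[ℝ]
    Lp Plane 2 (volume.restrict unitSquare) :=
  (coordFlip i).toContinuousLinearEquiv.toContinuousLinearMap.compLpL 2 _ ∘L
    (Lp.compMeasurePreservingₗᵢ ℝ _ (measurePreserving_coordFlip i)).toContinuousLinearMap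

lemma coeFn_flipField (i : Fin 2) (u : Lp Plane 2 (volume.restrict unitSquare)) :
    flipField i u =ᵐ[volume.restrict unitSquare] fun x => coordFlip i (u (coordFlip i x)) := by
  refine (ContinuousLinearMap.coeFn_compLpL _ _).trans ?_
  filter_upwards [Lp.coeFn_compMeasurePreserving u (measurePreserving_coordFlip i)] with x hx
  exact congrArg (coordFlip i) hx

lemma ae_comp_coordFlip (i : Fin 2) {p : Plane → Prop}
    (h : ∀ᵐ x ∂(volume.restrict unitSquare), p x) :
    ∀ᵐ x ∂(volume.restrict unitSquare), p (coordFlip i x) :=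
  (measurePreserving_coordFlip i).quasiMeasurePreserving.ae h

@[simp]
lemma flipField_flipField (i : Fin 2) (u : Lp Plane 2 (volume.restrict unitSquare)) :
    flipField i (flipField i u) = u := by
  refine Lp.ext ?_
  filter_upwards [coeFn_flipField i (flipField i u),
    ae_comp_coordFlip i (coeFn_flipField i u)] with x h1 h2
  rw [h1, h2, coordFlip_coordFlip, coordFlip_coordFlip]

lemma flipField_comm (i j : Fin 2) (u : Lp Plane 2 (volume.restrict unitSquare)) :
    flipField i (flipField j u) = flipField j (flipField i u) := by
  refine Lp.ext ?_
  filter_upwards [coeFn_flipField i (flipField j u), ae_comp_coordFlip i (coeFn_flipField j u),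
    coeFn_flipField j (flipField i u), ae_comp_coordFlip j (coeFn_flipField i u)]
    with x h1 h2 h3 h4
  rw [h1, h2, h3, h4, coordFlip_comm, coordFlip_comm j i x]

lemma inner_flipField_flipField (i : Fin 2) (u v : Lp Plane 2 (volume.restrict unitSquare)) :
    inner ℝ (flipField i u) (flipField i v) = inner ℝ u v := by
  rw [L2.inner_def, L2.inner_def, ← (measurePreserving_coordFlip i).integral_comp
    (coordFlip i).toHomeomorph.measurableEmbedding]
  refine integral_congr_ae ?_
  filter_upwards [ae_comp_coordFlip i (coeFn_flipField i u),
    ae_comp_coordFlip i (coeFn_flipField i v)] with x h1 h2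
  rw [h1, h2, LinearIsometryEquiv.inner_map_map, coordFlip_coordFlip]

lemma flipField_signMul_self (i : Fin 2) (u : Lp Plane 2 (volume.restrict unitSquare)) :
    flipField i (signMul i u) = -signMul i (flipField i u) := by
  refine Lp.ext ?_
  filter_upwards [coeFn_flipField i (signMul i u), ae_comp_coordFlip i (coeFn_signMul i u),
    coeFn_signMul i (flipField i u), coeFn_flipField i u, Lp.coeFn_neg (signMul i (flipField i u)),
    ae_restrict_of_ae (ae_coord_ne_zero i)] with x h1 h2 h3 h4 h5 h6
  rw [h1, h2, h5, Pi.neg_apply, h3, h4, map_smul, signAt_coordFlip_self h6, neg_smul]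

lemma flipField_signMul_of_ne {i j : Fin 2} (h : j ≠ i)
    (u : Lp Plane 2 (volume.restrict unitSquare)) :
    flipField i (signMul j u) = signMul j (flipField i u) := by
  refine Lp.ext ?_
  filter_upwards [coeFn_flipField i (signMul j u), ae_comp_coordFlip i (coeFn_signMul j u),
    coeFn_signMul j (flipField i u), coeFn_flipField i u] with x h1 h2 h3 h4
  rw [h1, h2, h3, h4, map_smul, signAt_coordFlip_of_ne h]

/-! ### H¹₀ of the square under reflections and under multiplication by signs. -/

lemma continuous_gradient_of_contDiff {φ : Plane → ℝ} (hφ : ContDiff ℝ ∞ φ) :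
    Continuous (∇ φ) :=
  (InnerProductSpace.toDual ℝ Plane).symm.continuous.comp (hφ.continuous_fderiv (by simp))

lemma norm_gradient (φ : Plane → ℝ) (x : Plane) : ‖∇ φ x‖ = ‖fderiv ℝ φ x‖ := by
  rw [gradient, LinearIsometryEquiv.norm_map]

lemma hasCompactSupport_gradient {φ : Plane → ℝ} (hφ : HasCompactSupport φ) :
    HasCompactSupport (∇ φ) :=
  (hφ.fderiv (𝕜 := ℝ)).comp_left (map_zero _)

lemma exists_testPair {Ω : Set Plane} {φ : Plane → ℝ} (hφ : ContDiff ℝ ∞ φ)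
    (hc : HasCompactSupport φ) (hs : tsupport φ ⊆ Ω) : ∃ p ∈ testPairs Ω,
      p.fst =ᵐ[volume.restrict Ω] φ ∧ p.snd =ᵐ[volume.restrict Ω] ∇ φ := by
  have h1 : MemLp φ 2 (volume.restrict Ω) :=
    (hφ.continuous.memLp_of_hasCompactSupport hc).restrict _
  have h2 : MemLp (∇ φ) 2 (volume.restrict Ω) :=
    ((continuous_gradient_of_contDiff hφ).memLp_of_hasCompactSupport
      (hasCompactSupport_gradient hc)).restrict _
  exact ⟨WithLp.toLp 2 (h1.toLp φ, h2.toLp (∇ φ)),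
    ⟨φ, hφ, hc, hs, h1.coeFn_toLp, h2.coeFn_toLp⟩, h1.coeFn_toLp, h2.coeFn_toLp⟩

/-- The operator `(u, g) ↦ (A u, B g)`. -/
def graphMap {Ω : Set Plane} (A : Lp ℝ 2 (volume.restrict Ω) →L[ℝ] Lp ℝ 2 (volume.restrict Ω))
    (B : Lp Plane 2 (volume.restrict Ω) →L[ℝ] Lp Plane 2 (volume.restrict Ω)) :
    GraphSpace Ω →L[ℝ] GraphSpace Ω :=
  (WithLp.prodContinuousLinearEquiv 2 ℝ _ _).symm.toContinuousLinearMap ∘L A.prodMap B ∘L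
    (WithLp.prodContinuousLinearEquiv 2 ℝ _ _).toContinuousLinearMap

lemma map_mem_sobolevZero {Ω : Set Plane} (Φ : GraphSpace Ω →L[ℝ] GraphSpace Ω)
    (h : ∀ p ∈ testPairs Ω, Φ p ∈ sobolevZero Ω) {p : GraphSpace Ω} (hp : p ∈ sobolevZero Ω) :
    Φ p ∈ sobolevZero Ω := by
  have h1 : testPairs Ω ≤ (sobolevZero Ω).comap Φ.toLinearMap := h
  exact Submodule.topologicalClosure_minimal _ h1
    ((testPairs Ω).isClosed_topologicalClosure.preimage Φ.continuous) hp

lemma gradient_comp_coordFlip {φ : Plane → ℝ} (hφ : Differentiable ℝ φ) (i : Fin 2) (x : Plane) :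
    ∇ (fun y => φ (coordFlip i y)) x = coordFlip i (∇ φ (coordFlip i x)) := by
  have h1 : HasFDerivAt (fun y => φ (coordFlip i y)) ((fderiv ℝ φ (coordFlip i x)).comp
      (coordFlip i).toContinuousLinearEquiv.toContinuousLinearMap) x :=
    (hφ _).hasFDerivAt.comp x (coordFlip i).toContinuousLinearEquiv.hasFDerivAt
  refine ext_inner_right ℝ fun w => ?_
  rw [inner_gradient_left, h1.fderiv, inner_coordFlip_left, inner_gradient_left]
  rfl

lemma testPairs_flip {p : GraphSpace unitSquare} (i : Fin 2) {φ : Plane → ℝ}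
    (hφ : ContDiff ℝ ∞ φ) (hc : HasCompactSupport φ) (hs : tsupport φ ⊆ unitSquare)
    (h1 : p.fst =ᵐ[volume.restrict unitSquare] φ)
    (h2 : p.snd =ᵐ[volume.restrict unitSquare] ∇ φ) :
    ContDiff ℝ ∞ (fun x => φ (coordFlip i x)) ∧
      HasCompactSupport (fun x => φ (coordFlip i x)) ∧
      tsupport (fun x => φ (coordFlip i x)) ⊆ unitSquare ∧
      (graphMap (flipFun i) (flipField i) p).fst =ᵐ[volume.restrict unitSquare]
        (fun x => φ (coordFlip i x)) ∧
      (graphMap (flipFun i) (flipField i) p).snd =ᵐ[volume.restrict unitSquare]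
        ∇ fun x => φ (coordFlip i x) := by
  refine ⟨hφ.comp (coordFlip i).contDiff, hc.comp_homeomorph (coordFlip i).toHomeomorph, ?_, ?_, ?_⟩
  · intro x hx
    have h3 := tsupport_comp_subset_preimage φ (coordFlip i).continuous hx
    exact (coordFlip_mem_unitSquare i x).1 (hs h3)
  · filter_upwards [coeFn_flipFun i p.fst, ae_comp_coordFlip i h1] with x h3 h4
    exact h3.trans h4
  · filter_upwards [coeFn_flipField i p.snd, ae_comp_coordFlip i h2] with x h3 h4
    rw [gradient_comp_coordFlip (hφ.differentiable (by simp)), ← h4]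
    exact h3

lemma flip_mem_sobolevZero (i : Fin 2) {p : GraphSpace unitSquare}
    (hp : p ∈ sobolevZero unitSquare) :
    graphMap (flipFun i) (flipField i) p ∈ sobolevZero unitSquare := by
  refine map_mem_sobolevZero _ ?_ hp
  rintro p ⟨φ, hφ, hc, hs, h1, h2⟩
  exact (testPairs unitSquare).le_topologicalClosure ⟨_, testPairs_flip i hφ hc hs h1 h2⟩

lemma Lp_tendsto_of_bounded {α E : Type*} [MeasurableSpace α] {μ : Measure α} [IsFiniteMeasure μ]
    [NormedAddCommGroup E] [InnerProductSpace ℝ E] (F : ℕ → Lp E 2 μ) (G : Lp E 2 μ) (C : ℝ)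
    (hF : ∀ n, ∀ᵐ x ∂μ, ‖F n x‖ ≤ C)
    (h : ∀ᵐ x ∂μ, Filter.Tendsto (fun n => F n x) Filter.atTop (nhds (G x))) :
    Filter.Tendsto F Filter.atTop (nhds G) := by
  have hG : ∀ᵐ x ∂μ, ‖G x‖ ≤ C := by
    filter_upwards [ae_all_iff.2 hF, h] with x h1 h2
    exact le_of_tendsto h2.norm (Filter.Eventually.of_forall h1)
  have h3 : Filter.Tendsto (fun n => ∫ x, ‖F n x - G x‖ ^ 2 ∂μ) Filter.atTop
      (nhds (∫ _, (0 : ℝ) ∂μ)) := by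
    refine tendsto_integral_of_dominated_convergence (fun _ => (C + C) ^ 2) (fun n => ?_)
      (integrable_const _) (fun n => ?_) ?_
    · exact (((Lp.aestronglyMeasurable (F n)).sub (Lp.aestronglyMeasurable G)).norm.pow 2)
    · filter_upwards [hF n, hG] with x h1 h2
      rw [Real.norm_eq_abs, abs_of_nonneg (by positivity)]
      exact pow_le_pow_left₀ (norm_nonneg _) ((norm_sub_le _ _).trans (add_le_add h1 h2)) 2
    · filter_upwards [h] with x h1
      have := ((h1.sub_const (G x)).norm.pow 2)
      simpa using this
  have h4 : ∀ n, ‖F n - G‖ ^ 2 = ∫ x, ‖F n x - G x‖ ^ 2 ∂μ := by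
    intro n
    rw [← real_inner_self_eq_norm_sq, L2.inner_def]
    refine integral_congr_ae ?_
    filter_upwards [Lp.coeFn_sub (F n) G] with x hx
    rw [hx, real_inner_self_eq_norm_sq, Pi.sub_apply]
  rw [tendsto_iff_norm_sub_tendsto_zero]
  have h5 := h3.sqrt
  simp only [← h4, Real.sqrt_sq (norm_nonneg _), integral_zero, Real.sqrt_zero] at h5
  exact h5

/-- The bound on t η'(t) is invariant under scaling, so it serves all the functions t ↦ η(n t) at
once. -/
lemma exists_smooth_sign : ∃ (η : ℝ → ℝ) (M : ℝ), ContDiff ℝ ∞ η ∧ (∀ t, |η t| ≤ 1) ∧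
    (∀ t, 1 < t → η t = 1) ∧ (∀ t, t < -1 → η t = -1) ∧ (∀ t, 1 < |t| → deriv η t = 0) ∧
    ∀ t, |t * deriv η t| ≤ M := by
  let η : ℝ → ℝ := fun t => 2 * Real.smoothTransition ((t + 1) / 2) - 1
  have hη : ContDiff ℝ ∞ η :=
    (contDiff_const.mul (Real.smoothTransition.contDiff.comp
      ((contDiff_id.add contDiff_const).div_const 2))).sub contDiff_const
  have h1 : ∀ t, 1 < t → η t = 1 := fun t ht => by
    simp only [η]
    rw [Real.smoothTransition.one_of_one_le (by linarith)]
    norm_num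
  have h2 : ∀ t, t < -1 → η t = -1 := fun t ht => by
    simp only [η]
    rw [Real.smoothTransition.zero_of_nonpos (by linarith)]
    norm_num
  have h3 : ∀ t, 1 < |t| → deriv η t = 0 := by
    intro t ht
    rcases lt_abs.1 ht with h | h
    · have : η =ᶠ[nhds t] fun _ => 1 := by
        filter_upwards [lt_mem_nhds h] with s hs using h1 s hs
      rw [this.deriv_eq, deriv_const]
    · have : η =ᶠ[nhds t] fun _ => -1 := by
        filter_upwards [gt_mem_nhds (show t < -1 by linarith)] with s hs using h2 s hs
      rw [this.deriv_eq, deriv_const]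
  have h4 : Continuous fun t => t * deriv η t := continuous_id.mul (hη.continuous_deriv (by simp))
  obtain ⟨M, hM⟩ := (isCompact_Icc (a := (-1 : ℝ)) (b := 1)).exists_bound_of_continuousOn
    h4.continuousOn
  refine ⟨η, max M 0, hη, fun t => ?_, h1, h2, h3, fun t => ?_⟩
  · have := Real.smoothTransition.nonneg ((t + 1) / 2)
    have := Real.smoothTransition.le_one ((t + 1) / 2)
    rw [abs_le]
    constructor <;> simp only [η] <;> linarith
  · by_cases h : 1 < |t|
    · simp [h3 t h]
    · exact (hM t (abs_le.1 (not_lt.1 h))).trans (le_max_left _ _)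

lemma gradient_comp_coord_mul {η : ℝ → ℝ} (hη : Differentiable ℝ η) {φ : Plane → ℝ}
    (hφ : Differentiable ℝ φ) (i : Fin 2) (c : ℝ) (x : Plane) :
    ∇ (fun y : Plane => η (c * y i) * φ y) x = η (c * x i) • ∇ φ x +
      (φ x * (c * deriv η (c * x i))) • EuclideanSpace.single i (1 : ℝ) := by
  have h0 : HasFDerivAt (fun y : Plane => c * y i)
      (c • (EuclideanSpace.proj i : Plane →L[ℝ] ℝ)) x :=
    (EuclideanSpace.proj i : Plane →L[ℝ] ℝ).hasFDerivAt.const_mul c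
  have h1 : HasFDerivAt (fun y : Plane => η (c * y i)) _ x :=
    (hη (c * x i)).hasDerivAt.comp_hasFDerivAt x h0
  have h2 := h1.mul (hφ x).hasFDerivAt
  refine ext_inner_right ℝ fun w => ?_
  rw [inner_gradient_left]
  have h3 := h2.fderiv
  rw [show (fun y : Plane => η (c * y i) * φ y) = (fun y : Plane => η (c * y i)) * φ from rfl, h3,
    inner_add_left, real_inner_smul_left, real_inner_smul_left, inner_gradient_left]
  simp [EuclideanSpace.inner_single_left]
  ring

lemma abs_le_of_odd {φ : Plane → ℝ} {K : NNReal} (hK : LipschitzWith K φ) {i : Fin 2}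
    (hodd : ∀ x, φ (coordFlip i x) = -φ x) (x : Plane) : |φ x| ≤ K * |x i| := by
  have h1 := hK.dist_le_mul x (coordFlip i x)
  rw [dist_eq_norm, dist_eq_norm, norm_sub_coordFlip, hodd, Real.norm_eq_abs, sub_neg_eq_add,
    ← two_mul, abs_mul, abs_two] at h1
  linarith

/-- The sign is smoothed to η((n + 1) x_i). The dangerous gradient term φ (n + 1) η'((n + 1) x_i)
stays bounded because oddness forces |φ| ≤ K |x_i|, and it is eventually zero at each point off the
axis. Dominated convergence finishes. -/
lemma signMul_testPair_mem {p : GraphSpace unitSquare} (i : Fin 2) {φ : Plane → ℝ}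
    (hφ : ContDiff ℝ ∞ φ) (hc : HasCompactSupport φ) (hs : tsupport φ ⊆ unitSquare)
    (h1 : p.fst =ᵐ[volume.restrict unitSquare] φ)
    (h2 : p.snd =ᵐ[volume.restrict unitSquare] ∇ φ) (hodd : ∀ x, φ (coordFlip i x) = -φ x) :
    graphMap (signMul i) (signMul i) p ∈ sobolevZero unitSquare := by
  obtain ⟨η, M, hη, hη1, hpos, hneg, hderiv, hM⟩ := exists_smooth_sign
  obtain ⟨K, hK⟩ := hφ.lipschitzWith_of_hasCompactSupport hc (by simp)
  obtain ⟨C₀, hC₀⟩ := hφ.continuous.bounded_above_of_compact_support hc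
  obtain ⟨C₁, hC₁⟩ := (continuous_gradient_of_contDiff hφ).bounded_above_of_compact_support
    (hasCompactSupport_gradient hc)
  let ψ : ℕ → Plane → ℝ := fun n x => η ((n + 1 : ℝ) * x i) * φ x
  have hψ : ∀ n, ContDiff ℝ ∞ (ψ n) := fun n =>
    (hη.comp (contDiff_const.mul (EuclideanSpace.proj i : Plane →L[ℝ] ℝ).contDiff)).mul hφ
  have hgrad : ∀ n x, ∇ (ψ n) x = η ((n + 1 : ℝ) * x i) • ∇ φ x +
      (φ x * ((n + 1 : ℝ) * deriv η ((n + 1 : ℝ) * x i))) • EuclideanSpace.single i (1 : ℝ) :=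
    fun n x => gradient_comp_coord_mul (hη.differentiable (by simp))
      (hφ.differentiable (by simp)) i _ x
  choose q hq hq1 hq2 using fun n => exists_testPair (hψ n) (hc.mul_left (f := fun x : Plane =>
    η ((n + 1 : ℝ) * x i))) ((tsupport_mul_subset_right (f := fun x : Plane =>
      η ((n + 1 : ℝ) * x i))).trans hs)
  have hlim : ∀ᵐ x ∂(volume.restrict unitSquare), ∀ᶠ n : ℕ in Filter.atTop,
      η ((n + 1 : ℝ) * x i) = signAt i x ∧ deriv η ((n + 1 : ℝ) * x i) = 0 := by
    filter_upwards [ae_restrict_of_ae (ae_coord_ne_zero i)] with x hx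
    obtain ⟨N, hN⟩ := exists_nat_gt (1 / |x i|)
    filter_upwards [Filter.eventually_ge_atTop N] with n hn
    have hx0 : 0 < |x i| := abs_pos.2 hx
    have h3 : 1 < ((n : ℝ) + 1) * |x i| := by
      rw [div_lt_iff₀ hx0] at hN
      have : (N : ℝ) ≤ n := by exact_mod_cast hn
      nlinarith
    refine ⟨?_, hderiv _ (by rwa [abs_mul, abs_of_pos (by positivity : (0 : ℝ) < n + 1)])⟩
    rcases hx.lt_or_gt with h | h
    · rw [abs_of_neg h] at h3
      rw [hneg _ (by linarith), signAt, if_neg h.not_gt]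
    · rw [abs_of_pos h] at h3
      rw [hpos _ h3, signAt, if_pos h]
  have hfst : Filter.Tendsto (fun n => (q n).fst) Filter.atTop (nhds (signMul i p.fst)) := by
    refine Lp_tendsto_of_bounded _ _ C₀ (fun n => ?_) ?_
    · filter_upwards [hq1 n] with x hx
      rw [hx, norm_mul]
      exact (mul_le_of_le_one_left (norm_nonneg _) (hη1 _)).trans (hC₀ x)
    · filter_upwards [ae_all_iff.2 hq1, h1, coeFn_signMul i p.fst, hlim] with x e1 e2 e3 e4
      refine tendsto_const_nhds.congr' ?_
      filter_upwards [e4] with n e5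
      rw [e1, e3, e2, ← e5.1]
      rfl
  have hsnd : Filter.Tendsto (fun n => (q n).snd) Filter.atTop (nhds (signMul i p.snd)) := by
    refine Lp_tendsto_of_bounded _ _ (C₁ + K * M) (fun n => ?_) ?_
    · filter_upwards [hq2 n] with x hx
      rw [hx, hgrad]
      refine (norm_add_le _ _).trans (add_le_add ?_ ?_)
      · rw [norm_smul]
        exact (mul_le_of_le_one_left (norm_nonneg _) (hη1 _)).trans (hC₁ x)
      · rw [norm_smul, PiLp.norm_single, norm_one, mul_one, norm_mul, Real.norm_eq_abs,
          Real.norm_eq_abs]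
        calc |φ x| * |((n : ℝ) + 1) * deriv η (((n : ℝ) + 1) * x i)|
            ≤ (K * |x i|) * |((n : ℝ) + 1) * deriv η (((n : ℝ) + 1) * x i)| :=
              mul_le_mul_of_nonneg_right (abs_le_of_odd hK hodd x) (abs_nonneg _)
          _ = K * |(((n : ℝ) + 1) * x i) * deriv η (((n : ℝ) + 1) * x i)| := by
              rw [abs_mul, abs_mul, abs_mul]; ring
          _ ≤ K * M := mul_le_mul_of_nonneg_left (hM _) K.2
    · filter_upwards [ae_all_iff.2 hq2, h2, coeFn_signMul i p.snd, hlim] with x e1 e2 e3 e4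
      refine tendsto_const_nhds.congr' ?_
      filter_upwards [e4] with n e5
      rw [e1, e3, e2, hgrad, e5.1, e5.2]
      simp
  have hq' : Filter.Tendsto q Filter.atTop (nhds (graphMap (signMul i) (signMul i) p)) :=
    ((WithLp.prodContinuousLinearEquiv 2 ℝ _ _).symm.continuous.tendsto _).comp
      (hfst.prodMk_nhds hsnd)
  exact mem_closure_of_tendsto hq' (Filter.Eventually.of_forall hq)

/-- An odd function in `H¹₀` of the square, multiplied by the sign of the coordinate in which it is
odd, remains in `H¹₀`. -/
lemma signMul_mem_sobolevZero (i : Fin 2) {p : GraphSpace unitSquare}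
    (hp : p ∈ sobolevZero unitSquare) (hodd : graphMap (flipFun i) (flipField i) p = -p) :
    graphMap (signMul i) (signMul i) p ∈ sobolevZero unitSquare := by
  -- Test functions approximating p need not be odd, so they are antisymmetrized first; on the odd p
  -- itself this only produces a factor 2.
  let Φ : GraphSpace unitSquare →L[ℝ] GraphSpace unitSquare :=
    graphMap (signMul i) (signMul i) ∘L
      (ContinuousLinearMap.id ℝ _ - graphMap (flipFun i) (flipField i))
  have h1 : Φ p ∈ sobolevZero unitSquare := by
    refine map_mem_sobolevZero Φ ?_ hp
    rintro r ⟨φ, hφ, hc, hs, h1, h2⟩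
    obtain ⟨k1, k2, k3, k4, k5⟩ := testPairs_flip i hφ hc hs h1 h2
    refine signMul_testPair_mem (φ := fun x => φ x - φ (coordFlip i x)) i (hφ.sub k1)
      (hc.sub k2) ((tsupport_sub φ _).trans (union_subset hs k3)) ?_ ?_ ?_
    · filter_upwards [h1, k4, Lp.coeFn_sub r.fst (graphMap (flipFun i) (flipField i) r).fst]
        with x e1 e2 e3
      refine e3.trans ?_
      rw [Pi.sub_apply, e1, e2]
    · filter_upwards [h2, k5, Lp.coeFn_sub r.snd (graphMap (flipFun i) (flipField i) r).snd]
        with x e1 e2 e3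
      refine e3.trans ?_
      have d1 : DifferentiableAt ℝ φ x := hφ.differentiable (by simp) x
      have d2 : DifferentiableAt ℝ (fun x => φ (coordFlip i x)) x := k1.differentiable (by simp) x
      rw [Pi.sub_apply, e1, e2]
      simp only [gradient]
      rw [← map_sub, ← fderiv_sub d1 d2]
      rfl
    · intro x
      simp
  have h2 : Φ p = (2 : ℝ) • graphMap (signMul i) (signMul i) p := by
    simp only [Φ, ContinuousLinearMap.comp_apply, sub_apply,
      ContinuousLinearMap.id_apply, hodd, sub_neg_eq_add, map_add, two_smul]
  rw [h2] at h1
  exact ((sobolevZero unitSquare).smul_mem_iff two_ne_zero).1 h1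

/-! ### The Poincaré inequality. -/

/-- The Poincaré inequality. -/
lemma exists_norm_le_mul_norm_snd {Ω : Set Plane} (hΩ : Bornology.IsBounded Ω) :
    ∃ C : ℝ, 0 < C ∧ ∀ p ∈ sobolevZero Ω, ‖p‖ ≤ C * ‖p.snd‖ := by
  have hfin : volume Ω < ⊤ := hΩ.measure_lt_top
  have : IsFiniteMeasure ((volume : Measure Plane).restrict Ω) :=
    ⟨by rwa [Measure.restrict_apply_univ]⟩
  let K : ENNReal := eLpNormLESNormFDerivOneConst (volume : Measure Plane) 2 *
    (volume.restrict Ω) univ ^ (1 / (1 : ENNReal).toReal - 1 / (2 : ENNReal).toReal)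
  have hK : K ≠ ⊤ := by
    refine ENNReal.mul_ne_top ENNReal.coe_ne_top
      (ENNReal.rpow_ne_top_of_nonneg ?_ (measure_ne_top _ _))
    norm_num
  have htest : ∀ p ∈ testPairs Ω, ‖p.fst‖ ≤ K.toReal * ‖p.snd‖ := by
    rintro p ⟨φ, hφ, hc, hs, h1, h2⟩
    -- In dimension 2 the Sobolev inequality bounds the L² norm of φ by the L¹ norm of its gradient;
    -- Hölder on the bounded set passes from L¹ to L².
    have hconj : (Module.finrank ℝ Plane : NNReal).HolderConjugate 2 := by
      rw [finrank_euclideanSpace_fin]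
      exact NNReal.HolderConjugate.two_two
    have e1 := eLpNorm_le_eLpNorm_fderiv_one (volume : Measure Plane) (hφ.of_le (by simp)) hc hconj
    have e2 : eLpNorm (fderiv ℝ φ) 1 volume = eLpNorm (∇ φ) 1 (volume.restrict Ω) := by
      have hsupp : Function.support (∇ φ) ⊆ Ω := by
        intro x hx
        refine hs (support_fderiv_subset ℝ (f := φ) fun h => hx ?_)
        simp [gradient, h]
      rw [eLpNorm_restrict_eq_of_support_subset hsupp]
      exact eLpNorm_congr_norm_ae (Filter.Eventually.of_forall fun x => (norm_gradient φ x).symm)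
    have e3 := eLpNorm_le_eLpNorm_mul_rpow_measure_univ (μ := volume.restrict Ω)
      (p := 1) (q := 2) (by norm_num)
      (continuous_gradient_of_contDiff hφ).aestronglyMeasurable
    have e4 : eLpNorm p.fst 2 (volume.restrict Ω) ≤ K * eLpNorm p.snd 2 (volume.restrict Ω) := by
      rw [eLpNorm_congr_ae h1, eLpNorm_congr_ae h2]
      refine (eLpNorm_mono_measure φ Measure.restrict_le_self).trans (e1.trans ?_)
      rw [e2, mul_assoc]
      refine mul_le_mul_right (e3.trans ?_) _
      rw [mul_comm]
    rw [Lp.norm_def, Lp.norm_def, ← ENNReal.toReal_mul]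
    exact ENNReal.toReal_mono (ENNReal.mul_ne_top hK (Lp.eLpNorm_ne_top _)) e4
  have hclosed : IsClosed {p : GraphSpace Ω | ‖p.fst‖ ≤ K.toReal * ‖p.snd‖} := by
    have c := (WithLp.prodContinuousLinearEquiv 2 ℝ (Lp ℝ 2 ((volume : Measure Plane).restrict Ω))
      (Lp Plane 2 ((volume : Measure Plane).restrict Ω))).continuous
    exact isClosed_le c.fst.norm (continuous_const.mul c.snd.norm)
  refine ⟨K.toReal + 1, by positivity, fun p hp => ?_⟩
  have h1 : ‖p.fst‖ ≤ K.toReal * ‖p.snd‖ := closure_minimal htest hclosed hp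
  have h2 : ‖p‖ ≤ ‖p.fst‖ + ‖p.snd‖ := by
    rw [WithLp.prod_norm_eq_of_L2]
    refine Real.sqrt_le_iff.2 ⟨by positivity, ?_⟩
    nlinarith [norm_nonneg p.fst, norm_nonneg p.snd]
  linarith

/-! ### Energy projections of sign multiplications, in abstract form. -/

/-- A bounded operator `G : V → H` of Hilbert spaces (a gradient) which is bounded below, with two
commuting self-adjoint involutions `m i` of `H` (multiplications by signs) and two commuting
isometric involutions `F i` of `H` (reflections) which lift to `V`. -/
structure SignedGradient (V H : Type*) [NormedAddCommGroup V] [InnerProductSpace ℝ V]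
    [NormedAddCommGroup H] [InnerProductSpace ℝ H] where
  G : V →L[ℝ] H
  exists_norm_le : ∃ C : ℝ, 0 < C ∧ ∀ v : V, ‖v‖ ≤ C * ‖G v‖
  m : Fin 2 → H →L[ℝ] H
  m_m : ∀ i g, m i (m i g) = g
  m_comm : ∀ i j g, m i (m j g) = m j (m i g)
  inner_m_left : ∀ i g h, inner ℝ (m i g) h = inner ℝ g (m i h)
  F : Fin 2 → H →L[ℝ] H
  F_F : ∀ i g, F i (F i g) = g
  F_comm : ∀ i j g, F i (F j g) = F j (F i g)
  inner_F_F : ∀ i g h, inner ℝ (F i g) (F i h) = inner ℝ g h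
  F_m_self : ∀ i g, F i (m i g) = -m i (F i g)
  F_m_of_ne : ∀ {i j}, j ≠ i → ∀ g, F i (m j g) = m j (F i g)
  flip : Fin 2 → V →ₗ[ℝ] V
  G_flip : ∀ i v, G (flip i v) = F i (G v)
  exists_G_eq : ∀ {i v}, flip i v = -v → ∃ v', G v' = m i (G v)

namespace SignedGradient

variable {V H : Type*} [NormedAddCommGroup V] [InnerProductSpace ℝ V]
  [NormedAddCommGroup H] [InnerProductSpace ℝ H] (𝒢 : SignedGradient V H)

lemma G_injective : Function.Injective 𝒢.G := by
  obtain ⟨C, -, h⟩ := 𝒢.exists_norm_le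
  refine (injective_iff_map_eq_zero 𝒢.G).2 fun v hv => norm_le_zero_iff.1 ?_
  simpa [hv] using h v

lemma eq_of_inner_G {v v' : V}
    (h : ∀ w, inner ℝ (𝒢.G v) (𝒢.G w) = inner ℝ (𝒢.G v') (𝒢.G w)) : v = v' := by
  have h1 : inner ℝ (𝒢.G (v - v')) (𝒢.G (v - v')) = 0 := by
    nth_rewrite 1 [map_sub]
    rw [inner_sub_left, h, sub_self]
  exact sub_eq_zero.1 ((map_eq_zero_iff 𝒢.G 𝒢.G_injective).1 (inner_self_eq_zero.1 h1))

lemma flip_flip (i : Fin 2) (v : V) : 𝒢.flip i (𝒢.flip i v) = v :=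
  𝒢.G_injective (by rw [𝒢.G_flip, 𝒢.G_flip, 𝒢.F_F])

lemma flip_comm (i j : Fin 2) (v : V) :
    𝒢.flip i (𝒢.flip j v) = 𝒢.flip j (𝒢.flip i v) :=
  𝒢.G_injective (by simp only [𝒢.G_flip, 𝒢.F_comm i j])

/-- The functions with parity `s` in the `i`-th coordinate. -/
def parity (i : Fin 2) (s : ℝ) : Submodule ℝ V :=
  LinearMap.ker (𝒢.flip i - s • LinearMap.id)

lemma mem_parity {i : Fin 2} {s : ℝ} {v : V} : v ∈ 𝒢.parity i s ↔ 𝒢.flip i v = s • v := by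
  simp [parity, sub_eq_zero]

lemma exists_add_parity (i : Fin 2) (v : V) :
    ∃ a ∈ 𝒢.parity i 1, ∃ b ∈ 𝒢.parity i (-1), v = a + b ∧
      ∀ j s, v ∈ 𝒢.parity j s → a ∈ 𝒢.parity j s ∧ b ∈ 𝒢.parity j s := by
  refine ⟨(2 : ℝ)⁻¹ • (v + 𝒢.flip i v), ?_, (2 : ℝ)⁻¹ • (v - 𝒢.flip i v), ?_, ?_, ?_⟩
  · rw [𝒢.mem_parity, map_smul, map_add, 𝒢.flip_flip, one_smul, add_comm]
  · rw [𝒢.mem_parity, map_smul, map_sub, 𝒢.flip_flip, neg_one_smul, ← smul_neg, neg_sub]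
  · module
  · intro j s hv
    have h1 : 𝒢.flip i v ∈ 𝒢.parity j s := by
      rw [𝒢.mem_parity] at hv ⊢
      rw [𝒢.flip_comm, hv, map_smul]
    exact ⟨Submodule.smul_mem _ _ (add_mem hv h1), Submodule.smul_mem _ _ (sub_mem hv h1)⟩

/-- The bilinear form `(v, w) ↦ ⟪A ∇v, ∇w⟫`. -/
def energyForm (A : H →L[ℝ] H) : V →L[ℝ] V →L[ℝ] ℝ :=
  LinearMap.mkContinuous₂ (LinearMap.mk₂ ℝ (fun v w => inner ℝ (A (𝒢.G v)) (𝒢.G w))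
    (fun v v' w => by rw [map_add, map_add, inner_add_left])
    (fun c v w => by rw [map_smul, map_smul, real_inner_smul_left, smul_eq_mul])
    (fun v w w' => by rw [map_add, inner_add_right])
    (fun c v w => by rw [map_smul, real_inner_smul_right, smul_eq_mul]))
    (‖A‖ * ‖𝒢.G‖ * ‖𝒢.G‖) fun v w => by
      refine (norm_inner_le_norm _ _).trans ?_
      calc ‖A (𝒢.G v)‖ * ‖𝒢.G w‖ ≤ (‖A‖ * (‖𝒢.G‖ * ‖v‖)) * (‖𝒢.G‖ * ‖w‖) :=
            mul_le_mul ((A.le_opNorm _).trans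
              (mul_le_mul_of_nonneg_left (𝒢.G.le_opNorm v) (norm_nonneg _)))
              (𝒢.G.le_opNorm w) (norm_nonneg _) (by positivity)
        _ = _ := by ring

lemma energyForm_apply (A : H →L[ℝ] H) (v w : V) :
    𝒢.energyForm A v w = inner ℝ (A (𝒢.G v)) (𝒢.G w) := rfl

lemma isCoercive_energyForm {A : H →L[ℝ] H} {c : ℝ} (hc : 0 < c)
    (hA : ∀ g, c * ‖g‖ ^ 2 ≤ inner ℝ (A g) g) : IsCoercive (𝒢.energyForm A) := by
  obtain ⟨C, hC, h⟩ := 𝒢.exists_norm_le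
  refine ⟨c / C ^ 2, by positivity, fun v => ?_⟩
  rw [energyForm_apply]
  refine le_trans ?_ (hA _)
  rw [div_mul_eq_mul_div, div_mul_eq_mul_div, div_le_iff₀ (by positivity)]
  have h1 : ‖v‖ ^ 2 ≤ (C * ‖𝒢.G v‖) ^ 2 := pow_le_pow_left₀ (norm_nonneg _) (h v) 2
  nlinarith

lemma isCoercive_energyForm_id : IsCoercive (𝒢.energyForm (ContinuousLinearMap.id ℝ _)) :=
  𝒢.isCoercive_energyForm one_pos fun g => by
    rw [one_mul, ContinuousLinearMap.id_apply, real_inner_self_eq_norm_sq]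

lemma inner_m_comp_left {i j : Fin 2} (hij : i ≠ j)
    (g h : H) :
    inner ℝ ((𝒢.m 0 ∘L 𝒢.m 1) g) h = inner ℝ g (𝒢.m j (𝒢.m i h)) := by
  rw [ContinuousLinearMap.comp_apply, 𝒢.inner_m_left, 𝒢.inner_m_left]
  fin_cases i <;> fin_cases j
  · exact absurd rfl hij
  · rfl
  · exact congrArg (inner ℝ g) (𝒢.m_comm _ _ _)
  · exact absurd rfl hij

variable [CompleteSpace V]

lemma existsUnique_of_coercive {A : H →L[ℝ] H} {c : ℝ} (hc : 0 < c)
    (hA : ∀ g, c * ‖g‖ ^ 2 ≤ inner ℝ (A g) g) (f : V →L[ℝ] ℝ) :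
    ∃! w : V, ∀ v, inner ℝ (A (𝒢.G w)) (𝒢.G v) = f v := by
  have hco := 𝒢.isCoercive_energyForm hc hA
  let e := hco.continuousLinearEquivOfBilin
  have he : ∀ v w, inner ℝ (e v) w = inner ℝ (A (𝒢.G v)) (𝒢.G w) := fun v w =>
    hco.continuousLinearEquivOfBilin_apply v w
  have hf : ∀ v, inner ℝ ((InnerProductSpace.toDual ℝ V).symm f) v = f v := fun v =>
    InnerProductSpace.toDual_symm_apply
  refine ⟨e.symm ((InnerProductSpace.toDual ℝ V).symm f), fun v => ?_, fun w hw => ?_⟩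
  · rw [← he, e.apply_symm_apply, hf]
  · rw [ContinuousLinearEquiv.eq_symm_apply]
    refine ext_inner_right ℝ fun v => ?_
    rw [he, hf]
    exact hw v

variable [CompleteSpace H]

/-- The operator which represents `(v, w) ↦ ⟪A ∇v, ∇w⟫` in the energy inner product. -/
def energyOp (A : H →L[ℝ] H) : V →L[ℝ] V :=
  𝒢.isCoercive_energyForm_id.continuousLinearEquivOfBilin.symm.toContinuousLinearMap ∘L
    (ContinuousLinearMap.adjoint 𝒢.G ∘L A ∘L 𝒢.G)

section EnergyOp

variable {A : H →L[ℝ] H}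

lemma inner_G_energyOp (v w : V) :
    inner ℝ (𝒢.G (𝒢.energyOp A v)) (𝒢.G w) = inner ℝ (A (𝒢.G v)) (𝒢.G w) := by
  have h := 𝒢.isCoercive_energyForm_id.continuousLinearEquivOfBilin_apply (𝒢.energyOp A v) w
  rw [energyForm_apply, ContinuousLinearMap.id_apply] at h
  rw [← h]
  simp only [energyOp, ContinuousLinearMap.comp_apply, ContinuousLinearEquiv.coe_coe,
    ContinuousLinearEquiv.apply_symm_apply, ContinuousLinearMap.adjoint_inner_left]

lemma energyOp_eq {v v' : V}
    (h : ∀ w, inner ℝ (𝒢.G v') (𝒢.G w) = inner ℝ (A (𝒢.G v)) (𝒢.G w)) :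
    𝒢.energyOp A v = v' :=
  𝒢.eq_of_inner_G fun w => by rw [𝒢.inner_G_energyOp, h]

/-- When A ∇v is itself a gradient, projecting it onto gradients changes nothing. -/
lemma G_energyOp {v v' : V} (h : 𝒢.G v' = A (𝒢.G v)) :
    𝒢.G (𝒢.energyOp A v) = A (𝒢.G v) := by
  rw [𝒢.energyOp_eq (v' := v') fun w => by rw [h], h]

end EnergyOp

lemma energyOp_mem_parity {A : H →L[ℝ] H} {i : Fin 2} {r : ℝ}
    (hA : ∀ g, 𝒢.F i (A g) = r • A (𝒢.F i g)) {s : ℝ} {v : V}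
    (hv : v ∈ 𝒢.parity i s) : 𝒢.energyOp A v ∈ 𝒢.parity i (r * s) := by
  rw [𝒢.mem_parity] at hv ⊢
  refine 𝒢.eq_of_inner_G fun w => ?_
  have h1 : 𝒢.G w = 𝒢.F i (𝒢.G (𝒢.flip i w)) := by
    rw [𝒢.G_flip, 𝒢.F_F]
  rw [𝒢.G_flip, h1, 𝒢.inner_F_F, 𝒢.inner_G_energyOp,
    ← 𝒢.inner_F_F i, ← h1, hA, ← 𝒢.G_flip, hv, map_smul, map_smul, map_smul,
    smul_smul, real_inner_smul_left, real_inner_smul_left, 𝒢.inner_G_energyOp]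

/-- The energy projection of the multiplication by the sign of the `i`-th coordinate. -/
abbrev signOp (i : Fin 2) : V →L[ℝ] V := 𝒢.energyOp (𝒢.m i)

lemma signOp_mem_parity_self {i : Fin 2} {s : ℝ} {v : V} (hv : v ∈ 𝒢.parity i s) :
    𝒢.signOp i v ∈ 𝒢.parity i (-s) := by
  have := 𝒢.energyOp_mem_parity (A := 𝒢.m i) (r := -1)
    (fun g => by rw [𝒢.F_m_self, neg_one_smul]) hv
  rwa [neg_one_mul] at this

lemma signOp_mem_parity_of_ne {i j : Fin 2} (hij : j ≠ i) {s : ℝ} {v : V}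
    (hv : v ∈ 𝒢.parity i s) : 𝒢.signOp j v ∈ 𝒢.parity i s := by
  have := 𝒢.energyOp_mem_parity (A := 𝒢.m j) (r := 1)
    (fun g => by rw [𝒢.F_m_of_ne hij, one_smul]) hv
  rwa [one_mul] at this

lemma G_signOp {i : Fin 2} {v : V} (hv : v ∈ 𝒢.parity i (-1)) :
    𝒢.G (𝒢.signOp i v) = 𝒢.m i (𝒢.G v) := by
  rw [𝒢.mem_parity, neg_one_smul] at hv
  obtain ⟨v', h⟩ := 𝒢.exists_G_eq hv
  exact 𝒢.G_energyOp h

lemma signOp_signOp {i : Fin 2} {v : V} (hv : v ∈ 𝒢.parity i (-1)) :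
    𝒢.signOp i (𝒢.signOp i v) = v :=
  𝒢.energyOp_eq fun w => by rw [𝒢.G_signOp hv, 𝒢.m_m]

/-- The energy projection of the multiplication by the product of both signs. -/
abbrev signOpBoth : V →L[ℝ] V := 𝒢.energyOp (𝒢.m 0 ∘L 𝒢.m 1)

/-- The sign in which v is odd acts first, as a true multiplication; only the second sign is
projected. The order of the two operators matters. -/
lemma signOpBoth_eq_of_odd {i j : Fin 2} (hij : i ≠ j) {v : V} (hv : v ∈ 𝒢.parity i (-1)) :
    𝒢.signOpBoth v = 𝒢.signOp j (𝒢.signOp i v) := by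
  refine 𝒢.energyOp_eq fun w => ?_
  rw [𝒢.inner_G_energyOp, 𝒢.G_signOp hv, ContinuousLinearMap.comp_apply]
  fin_cases i <;> fin_cases j
  · exact absurd rfl hij
  · exact congrArg (inner ℝ · (𝒢.G w)) (𝒢.m_comm _ _ _)
  · rfl
  · exact absurd rfl hij

lemma signOpBoth_mem_parity {i : Fin 2} {s : ℝ} {v : V} (hv : v ∈ 𝒢.parity i s) :
    𝒢.signOpBoth v ∈ 𝒢.parity i (-s) := by
  rw [← neg_one_mul s]
  refine 𝒢.energyOp_mem_parity (fun g => ?_) hv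
  rw [ContinuousLinearMap.comp_apply, ContinuousLinearMap.comp_apply, neg_one_smul]
  fin_cases i
  · exact (𝒢.F_m_self 0 _).trans
      (by rw [𝒢.F_m_of_ne (show (1 : Fin 2) ≠ 0 by decide)]; rfl)
  · refine (𝒢.F_m_of_ne (show (0 : Fin 2) ≠ 1 by decide) _).trans ?_
    rw [← map_neg]
    exact congrArg (𝒢.m 0) (𝒢.F_m_self 1 _)

/-- Here neither sign acts as a true multiplication on v. However, the difference w of the two sides
is odd in both variables, so when both sides are tested against w the signs can be moved onto w,
where they are true multiplications. Hence w is orthogonal to itself. As `signOpBoth` is symmetric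
in i and j, this also makes the two sign operators commute on even-even functions. -/
lemma signOpBoth_eq_of_even {i j : Fin 2} (hij : i ≠ j) {v : V} (hi : v ∈ 𝒢.parity i 1)
    (hj : v ∈ 𝒢.parity j 1) : 𝒢.signOpBoth v = 𝒢.signOp i (𝒢.signOp j v) := by
  have hwi : 𝒢.signOpBoth v - 𝒢.signOp i (𝒢.signOp j v) ∈ 𝒢.parity i (-1) :=
    sub_mem (𝒢.signOpBoth_mem_parity hi)
      (𝒢.signOp_mem_parity_self (𝒢.signOp_mem_parity_of_ne hij.symm hi))
  have hwj : 𝒢.signOpBoth v - 𝒢.signOp i (𝒢.signOp j v) ∈ 𝒢.parity j (-1) :=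
    sub_mem (𝒢.signOpBoth_mem_parity hj)
      (𝒢.signOp_mem_parity_of_ne hij (𝒢.signOp_mem_parity_self hj))
  obtain ⟨w, hw⟩ : ∃ w, w = 𝒢.signOpBoth v - 𝒢.signOp i (𝒢.signOp j v) := ⟨_, rfl⟩
  rw [← hw] at hwi hwj
  have h1 : inner ℝ (𝒢.G (𝒢.signOp i (𝒢.signOp j v))) (𝒢.G w) =
      inner ℝ (𝒢.G (𝒢.signOpBoth v)) (𝒢.G w) := by
    rw [𝒢.inner_G_energyOp, 𝒢.inner_m_left, ← 𝒢.G_signOp hwi, 𝒢.inner_G_energyOp,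
      𝒢.inner_m_left, 𝒢.G_signOp hwi, 𝒢.inner_G_energyOp, 𝒢.inner_m_comp_left hij]
  have h2 : inner ℝ (𝒢.G w) (𝒢.G w) = 0 := by
    nth_rewrite 1 [hw]
    rw [map_sub, inner_sub_left, h1, sub_self]
  have h3 : w = 0 := (map_eq_zero_iff 𝒢.G 𝒢.G_injective).1 (inner_self_eq_zero.1 h2)
  exact sub_eq_zero.1 (hw.symm.trans h3)

/-- The operators `signOp 0`, `signOp 1`, `signOpBoth` with the parity classes. -/
def paritySystem : ParitySystem V where
  S := (𝒢.signOp 0).toLinearMap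
  T := (𝒢.signOp 1).toLinearMap
  R := 𝒢.signOpBoth.toLinearMap
  ee := 𝒢.parity 0 1 ⊓ 𝒢.parity 1 1
  oe := 𝒢.parity 0 (-1) ⊓ 𝒢.parity 1 1
  eo := 𝒢.parity 0 1 ⊓ 𝒢.parity 1 (-1)
  oo := 𝒢.parity 0 (-1) ⊓ 𝒢.parity 1 (-1)
  S_ee h := ⟨𝒢.signOp_mem_parity_self h.1, 𝒢.signOp_mem_parity_of_ne (by decide) h.2⟩
  S_oe h := ⟨by simpa using 𝒢.signOp_mem_parity_self h.1, 𝒢.signOp_mem_parity_of_ne (by decide) h.2⟩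
  S_eo h := ⟨𝒢.signOp_mem_parity_self h.1, 𝒢.signOp_mem_parity_of_ne (by decide) h.2⟩
  S_oo h := ⟨by simpa using 𝒢.signOp_mem_parity_self h.1, 𝒢.signOp_mem_parity_of_ne (by decide) h.2⟩
  T_ee h := ⟨𝒢.signOp_mem_parity_of_ne (by decide) h.1, 𝒢.signOp_mem_parity_self h.2⟩
  T_oe h := ⟨𝒢.signOp_mem_parity_of_ne (by decide) h.1, 𝒢.signOp_mem_parity_self h.2⟩
  T_eo h := ⟨𝒢.signOp_mem_parity_of_ne (by decide) h.1, by simpa using 𝒢.signOp_mem_parity_self h.2⟩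
  T_oo h := ⟨𝒢.signOp_mem_parity_of_ne (by decide) h.1, by simpa using 𝒢.signOp_mem_parity_self h.2⟩
  SS_oe h := 𝒢.signOp_signOp h.1
  SS_oo h := 𝒢.signOp_signOp h.1
  TT_eo h := 𝒢.signOp_signOp h.2
  TT_oo h := 𝒢.signOp_signOp h.2
  ST_ee h := (𝒢.signOpBoth_eq_of_even (by decide) h.1 h.2).symm.trans
    (𝒢.signOpBoth_eq_of_even (by decide) h.2 h.1)
  ST_oo h := (𝒢.signOpBoth_eq_of_odd (by decide) h.2).symm.trans
    (𝒢.signOpBoth_eq_of_odd (by decide) h.1)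
  R_ee h := 𝒢.signOpBoth_eq_of_even (by decide) h.2 h.1
  R_oe h := 𝒢.signOpBoth_eq_of_odd (by decide) h.1
  R_eo h := 𝒢.signOpBoth_eq_of_odd (by decide) h.2
  R_oo h := 𝒢.signOpBoth_eq_of_odd (by decide) h.1
  exists_add v := by
    obtain ⟨a, ha, b, hb, rfl, -⟩ := 𝒢.exists_add_parity 0 v
    obtain ⟨x, hx, q, hq, rfl, h1⟩ := 𝒢.exists_add_parity 1 a
    obtain ⟨p, hp, o, ho, rfl, h2⟩ := 𝒢.exists_add_parity 1 b
    exact ⟨x, ⟨(h1 _ _ ha).1, hx⟩, p, ⟨(h2 _ _ hb).1, hp⟩, q, ⟨(h1 _ _ ha).2, hq⟩, o,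
      ⟨(h2 _ _ hb).2, ho⟩, by abel⟩

end SignedGradient

/-! ### The square as an instance, and its quadrants in terms of signs. -/

instance : CompleteSpace SolSpace :=
  (testPairs unitSquare).isClosed_topologicalClosure.completeSpace_coe

/-- The weak gradient on `H¹₀(D)` as a bounded operator. -/
def gradL : SolSpace →L[ℝ] Lp Plane 2 (volume.restrict unitSquare) :=
  ContinuousLinearMap.snd ℝ _ _ ∘L
    (WithLp.prodContinuousLinearEquiv 2 ℝ _ _).toContinuousLinearMap ∘L
    (sobolevZero unitSquare).subtypeL

/-- The reflection on `H¹₀(D)`. -/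
def flipSol (i : Fin 2) : SolSpace →ₗ[ℝ] SolSpace :=
  (graphMap (flipFun i) (flipField i)).toLinearMap.restrict fun _ hp => flip_mem_sobolevZero i hp

/-- The weak gradient on the square, with the signs of the coordinates and the reflections. -/
def squareGradient : SignedGradient SolSpace (Lp Plane 2 (volume.restrict unitSquare)) where
  G := gradL
  exists_norm_le := by
    obtain ⟨C, hC, h⟩ := exists_norm_le_mul_norm_snd isBounded_unitSquare
    exact ⟨C, hC, fun v => h v v.2⟩
  m := signMul
  m_m := signMul_signMul
  m_comm := signMul_comm
  inner_m_left := inner_signMul_left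
  F := flipField
  F_F := flipField_flipField
  F_comm := flipField_comm
  inner_F_F := inner_flipField_flipField
  F_m_self := flipField_signMul_self
  F_m_of_ne := flipField_signMul_of_ne
  flip := flipSol
  G_flip _ _ := rfl
  exists_G_eq {i v} h :=
    ⟨⟨_, signMul_mem_sobolevZero i v.2 (congrArg Subtype.val h)⟩, rfl⟩

/-- The signs of the two coordinates on the quadrants. -/
def quadrantSign : Fin 4 → Fin 2 → ℝ := ![![-1, -1], ![1, -1], ![-1, 1], ![1, 1]]

lemma ae_indicator_quadrant : ∀ᵐ x ∂(volume.restrict unitSquare), ∀ i,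
    (quadrant i).indicator (1 : Plane → ℝ) x =
      (1 + quadrantSign i 0 * signAt 0 x) * (1 + quadrantSign i 1 * signAt 1 x) / 4 := by
  filter_upwards [ae_restrict_of_ae (ae_coord_ne_zero 0), ae_restrict_of_ae (ae_coord_ne_zero 1),
    ae_restrict_mem isOpen_unitSquare.measurableSet] with x h0 h1 hx i
  obtain ⟨⟨a1, a2⟩, b1, b2⟩ := hx
  rw [one_div] at a2 b2
  rcases h0.lt_or_gt with h0 | h0 <;> rcases h1.lt_or_gt with h1 | h1 <;> fin_cases i <;>
    simp [quadrant, quadrantSign, rect, signAt, indicator, h0, h1, h0.not_gt, h1.not_gt, a1, a2,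
      b1, b2] <;> norm_num

/-- Almost every point lies in exactly one quadrant, so a single term θ y_i survives, and it is at
most θ. -/
lemma ae_one_sub_le_coeff {θ : ℝ} (hθ : 0 ≤ θ) {y : Fin 4 → ℝ} (hy : y ∈ paramCube) :
    ∀ᵐ x ∂(volume.restrict unitSquare), 1 - θ ≤ coeff θ y x := by
  filter_upwards [ae_indicator_quadrant] with x hx
  have h : ∀ i, θ * y i ≤ θ := fun i => mul_le_of_le_one_right hθ (hy.2 i)
  unfold coeff
  simp only [hx, Fin.sum_univ_four, quadrantSign]
  unfold signAt
  split_ifs <;> simp <;> nlinarith [h 0, h 1, h 2, h 3]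

/-! ### The parametric problem as a Neumann series. -/

namespace SignedGradient

variable {V H : Type*} [NormedAddCommGroup V] [InnerProductSpace ℝ V]
  [NormedAddCommGroup H] [InnerProductSpace ℝ H] (𝒢 : SignedGradient V H)

/-- Multiplication by `θ χ` on gradient fields, with `χ` the indicator of the `i`-th quadrant. -/
def quadrantMul (θ : ℝ) (i : Fin 4) : H →L[ℝ] H :=
  (θ / 4) • (ContinuousLinearMap.id ℝ _ + quadrantSign i 0 • 𝒢.m 0 + quadrantSign i 1 • 𝒢.m 1 +
    (quadrantSign i 0 * quadrantSign i 1) • (𝒢.m 0 ∘L 𝒢.m 1))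

lemma quadrantMul_apply (θ : ℝ) (i : Fin 4) (g : H) :
    𝒢.quadrantMul θ i g = (θ / 4) • (g + quadrantSign i 0 • 𝒢.m 0 g +
      quadrantSign i 1 • 𝒢.m 1 g + (quadrantSign i 0 * quadrantSign i 1) • 𝒢.m 0 (𝒢.m 1 g)) :=
  rfl

/-- Multiplication by the diffusion coefficient. -/
def coeffMul (θ : ℝ) (y : Fin 4 → ℝ) : H →L[ℝ] H :=
  ContinuousLinearMap.id ℝ _ - ∑ i, y i • 𝒢.quadrantMul θ i

lemma inner_coeffMul_left (θ : ℝ) (y : Fin 4 → ℝ) (g h : H) :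
    inner ℝ (𝒢.coeffMul θ y g) h = inner ℝ g h - ∑ i, y i * inner ℝ (𝒢.quadrantMul θ i g) h := by
  simp [coeffMul, inner_sub_left, sum_inner, real_inner_smul_left]

variable [CompleteSpace V] [CompleteSpace H]

/-- The operator `y ↦ ∑ i, y i A₀⁻¹ Aᵢ` of the Neumann series. -/
def neumannOp (θ : ℝ) : (Fin 4 → ℝ) →L[ℝ] V →L[ℝ] V :=
  ∑ i, (ContinuousLinearMap.proj i : (Fin 4 → ℝ) →L[ℝ] ℝ).smulRight
    (𝒢.energyOp (𝒢.quadrantMul θ i))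

lemma neumannOp_apply (θ : ℝ) (y : Fin 4 → ℝ) (v : V) :
    𝒢.neumannOp θ y v = ∑ i, y i • 𝒢.energyOp (𝒢.quadrantMul θ i) v := by
  simp [neumannOp]

lemma inner_G_one_sub_neumannOp (θ : ℝ) (y : Fin 4 → ℝ) (v w : V) :
    inner ℝ (𝒢.G ((1 - 𝒢.neumannOp θ y) v)) (𝒢.G w) =
      inner ℝ (𝒢.coeffMul θ y (𝒢.G v)) (𝒢.G w) := by
  simp [neumannOp_apply, inner_coeffMul_left, inner_sub_left, sum_inner, real_inner_smul_left,
    inner_G_energyOp]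

lemma energyOp_quadrantMul (θ : ℝ) (i : Fin 4) (v : V) :
    𝒢.energyOp (𝒢.quadrantMul θ i) v = (θ / 4) • (v + quadrantSign i 0 • 𝒢.signOp 0 v +
      quadrantSign i 1 • 𝒢.signOp 1 v +
      (quadrantSign i 0 * quadrantSign i 1) • 𝒢.signOpBoth v) := by
  refine 𝒢.energyOp_eq fun w => ?_
  simp only [quadrantMul_apply, map_smul, map_add, inner_add_left, real_inner_smul_left,
    inner_G_energyOp, ContinuousLinearMap.comp_apply]

lemma eventually_eq_inverse {θ : ℝ} {f : V →L[ℝ] ℝ} {u : (Fin 4 → ℝ) → V}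
    {K : Set (Fin 4 → ℝ)} (hK : K ∈ nhds 0)
    (hu : ∀ y ∈ K, ∀ v, inner ℝ (𝒢.coeffMul θ y (𝒢.G (u y))) (𝒢.G v) = f v) :
    ∀ᶠ y in nhds 0, u y = Ring.inverse (1 - 𝒢.neumannOp θ y) (u 0) := by
  have hlt : ∀ᶠ y in nhds (0 : Fin 4 → ℝ), ‖𝒢.neumannOp θ y‖ < 1 := by
    refine ((𝒢.neumannOp θ).continuous.norm.tendsto 0).eventually_lt_const ?_
    simp
  filter_upwards [hK, hlt] with y hy hy1
  -- At y = 0 the coefficient is 1, so u(0) represents f in the energy inner product; the equation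
  -- at y says the same of (1 - L y) u(y).
  have h2 : (1 - 𝒢.neumannOp θ y) (u y) = u 0 := by
    refine 𝒢.eq_of_inner_G fun v => ?_
    have h3 := hu 0 (mem_of_mem_nhds hK) v
    rw [inner_coeffMul_left] at h3
    rw [inner_G_one_sub_neumannOp, hu y hy, ← h3]
    simp
  rw [← h2, ← mul_apply_eq_comp, Ring.inverse_mul_cancel _
    (isUnit_one_sub_of_norm_lt_one hy1), one_apply_eq_self]

/-- The solution map of the parametric problem is analytic at `0`, and its Taylor coefficients of
order at most `n` lie in a space of dimension at most `8 n + 5`. -/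
theorem analyticAt_and_exists_filtration {θ : ℝ} {f : V →L[ℝ] ℝ} {u : (Fin 4 → ℝ) → V}
    {K : Set (Fin 4 → ℝ)} (hK : K ∈ nhds 0)
    (hu : ∀ y ∈ K, ∀ v, inner ℝ (𝒢.coeffMul θ y (𝒢.G (u y))) (𝒢.G v) = f v) :
    AnalyticAt ℝ u 0 ∧ ∃ F : ℕ → Submodule ℝ V, Monotone F ∧
      (∀ n, FiniteDimensional ℝ (F n) ∧ Module.finrank ℝ (F n) ≤ 8 * n + 5) ∧
      ∀ ν, taylorCoeff u ν ∈ F (∑ i, ν i) := by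
  obtain ⟨F, ht, hmono, hS, hT, hR, hF⟩ := 𝒢.paritySystem.exists_filtration (u 0)
  obtain ⟨han, hcoeff⟩ := analyticAt_and_taylorCoeff_mem (𝒢.neumannOp θ) (u 0) u
    (𝒢.eventually_eq_inverse hK hu) F ht fun n y v hv => by
      rw [neumannOp_apply]
      refine Submodule.sum_mem _ fun i _ => Submodule.smul_mem _ _ ?_
      rw [energyOp_quadrantMul]
      exact Submodule.smul_mem _ _ (add_mem (add_mem (add_mem (hmono n hv)
        (Submodule.smul_mem _ _ (hS n hv))) (Submodule.smul_mem _ _ (hT n hv)))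
        (Submodule.smul_mem _ _ (hR n hv)))
  exact ⟨han, F, monotone_nat_of_le_succ hmono, hF, hcoeff⟩

end SignedGradient

/-! ### Identification of the abstract form with the weak formulation. -/

lemma coeFn_quadrantMul (θ : ℝ) (i : Fin 4) (g : Lp Plane 2 (volume.restrict unitSquare)) :
    squareGradient.quadrantMul θ i g =ᵐ[volume.restrict unitSquare]
      fun x => (θ * (quadrant i).indicator 1 x) • g x := by
  rw [squareGradient.quadrantMul_apply]
  change ⇑((θ / 4) • (g + quadrantSign i 0 • signMul 0 g + quadrantSign i 1 • signMul 1 g +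
    (quadrantSign i 0 * quadrantSign i 1) • signMul 0 (signMul 1 g))) =ᵐ[_] _
  set g0 := signMul 0 g with hg0
  set g1 := signMul 1 g with hg1
  set g01 := signMul 0 g1 with hg01
  filter_upwards [Lp.coeFn_smul (θ / 4) (g + quadrantSign i 0 • g0 + quadrantSign i 1 • g1 +
      (quadrantSign i 0 * quadrantSign i 1) • g01),
    Lp.coeFn_add (g + quadrantSign i 0 • g0 + quadrantSign i 1 • g1)
      ((quadrantSign i 0 * quadrantSign i 1) • g01),
    Lp.coeFn_add (g + quadrantSign i 0 • g0) (quadrantSign i 1 • g1),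
    Lp.coeFn_add g (quadrantSign i 0 • g0), Lp.coeFn_smul (quadrantSign i 0) g0,
    Lp.coeFn_smul (quadrantSign i 1) g1,
    Lp.coeFn_smul (quadrantSign i 0 * quadrantSign i 1) g01,
    coeFn_signMul 0 g, coeFn_signMul 1 g, coeFn_signMul 0 g1, ae_indicator_quadrant]
    with x e1 e2 e3 e4 e5 e6 e7 e8 e9 e10 e11
  rw [e1, Pi.smul_apply, e2, Pi.add_apply, e3, Pi.add_apply, e4, Pi.add_apply, e5, e6, e7,
    Pi.smul_apply, Pi.smul_apply, Pi.smul_apply, e8, e10, e9, e11]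
  module

lemma ae_coeff_mul_inner (θ : ℝ) (y : Fin 4 → ℝ) (g h : Lp Plane 2 (volume.restrict unitSquare)) :
    (fun x => inner ℝ (g x) (h x) -
      ∑ i, y i * inner ℝ (squareGradient.quadrantMul θ i g x) (h x))
        =ᵐ[volume.restrict unitSquare] fun x => coeff θ y x * inner ℝ (g x) (h x) := by
  filter_upwards [ae_all_iff.2 fun i => coeFn_quadrantMul θ i g] with x hx
  simp only [hx, coeff, real_inner_smul_left, sub_mul, one_mul, Finset.mul_sum, Finset.sum_mul]
  congr 1
  exact Finset.sum_congr rfl fun i _ => by ring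

lemma integrable_sum_inner_quadrantMul (θ : ℝ) (y : Fin 4 → ℝ)
    (g h : Lp Plane 2 (volume.restrict unitSquare)) : Integrable (fun x =>
      ∑ i, y i * inner ℝ (squareGradient.quadrantMul θ i g x) (h x))
      (volume.restrict unitSquare) :=
  integrable_finsetSum _ fun i _ =>
    (L2.integrable_inner (squareGradient.quadrantMul θ i g) h).const_mul (y i)

lemma inner_coeffMul (θ : ℝ) (y : Fin 4 → ℝ) (g h : Lp Plane 2 (volume.restrict unitSquare)) :
    inner ℝ (squareGradient.coeffMul θ y g) h =
      ∫ x in unitSquare, coeff θ y x * inner ℝ (g x) (h x) := by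
  rw [squareGradient.inner_coeffMul_left, ← integral_congr_ae (ae_coeff_mul_inner θ y g h),
    integral_sub (L2.integrable_inner g h) (integrable_sum_inner_quadrantMul θ y g h),
    integral_finsetSum _ fun i _ =>
      (L2.integrable_inner (squareGradient.quadrantMul θ i g) h).const_mul (y i)]
  simp only [integral_const_mul, L2.inner_def]

lemma mul_norm_sq_le_inner_coeffMul {θ : ℝ} (hθ : 0 ≤ θ) {y : Fin 4 → ℝ} (hy : y ∈ paramCube)
    (g : Lp Plane 2 (volume.restrict unitSquare)) :
    (1 - θ) * ‖g‖ ^ 2 ≤ inner ℝ (squareGradient.coeffMul θ y g) g := by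
  rw [inner_coeffMul, ← real_inner_self_eq_norm_sq, L2.inner_def, ← integral_const_mul]
  refine integral_mono_ae ((L2.integrable_inner g g).const_mul _)
    (((L2.integrable_inner g g).sub (integrable_sum_inner_quadrantMul θ y g g)).congr
      (ae_coeff_mul_inner θ y g g)) ?_
  filter_upwards [ae_one_sub_le_coeff hθ hy] with x hx
  exact mul_le_mul_of_nonneg_right hx real_inner_self_nonneg

lemma isWeakSolution_iff {θ : ℝ} {f : SolSpace →L[ℝ] ℝ} {y : Fin 4 → ℝ} {w : SolSpace} :
    IsWeakSolution θ f y w ↔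
      ∀ v, inner ℝ (squareGradient.coeffMul θ y (squareGradient.G w)) (squareGradient.G v) =
        f v :=
  forall_congr' fun v => by rw [inner_coeffMul]; rfl

lemma paramCube_mem_nhds_zero : paramCube ∈ nhds (0 : Fin 4 → ℝ) :=
  pi_Icc_mem_nhds (fun _ => by simp) (fun _ => by simp)

end

theorem theorem4p1 (θ : ℝ) (hθ0 : 0 < θ) (hθ1 : θ < 1) (f : SolSpace →L[ℝ] ℝ) :
    (∀ y ∈ paramCube, ∃! w : SolSpace, IsWeakSolution θ f y w) ∧
    ∀ u : (Fin 4 → ℝ) → SolSpace, (∀ y ∈ paramCube, IsWeakSolution θ f y (u y)) →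
      AnalyticAt ℝ u 0 ∧
      ∀ k : ℕ,
        (∃ (v : Fin (8 * k + 5) → SolSpace) (φ : Fin (8 * k + 5) → MvPolynomial (Fin 4) ℝ),
          (∀ l, (φ l).totalDegree = k) ∧
          ∀ y : Fin 4 → ℝ, taylorPartialSum u k y = ∑ l, MvPolynomial.eval y (φ l) • v l) ∧
        ∀ (μ : Measure paramCube) [IsProbabilityMeasure μ],
          ∃ hu : MemLp (fun y : paramCube => taylorPartialSum u k y) 2 μ,
            separationRank μ (fun y : paramCube => taylorPartialSum u k y) hu
              ≤ ((8 * k + 5 : ℕ) : Cardinal) := by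
  refine ⟨fun y hy => ?_, fun u hu => ?_⟩
  · simp only [isWeakSolution_iff]
    exact squareGradient.existsUnique_of_coercive (sub_pos.2 hθ1)
      (mul_norm_sq_le_inner_coeffMul hθ0.le hy) f
  · obtain ⟨han, F, hmono, hF, hcoeff⟩ := squareGradient.analyticAt_and_exists_filtration
      paramCube_mem_nhds_zero fun y hy => isWeakSolution_iff.1 (hu y hy)
    refine ⟨han, fun k => ?_⟩
    obtain ⟨v, φ, hdeg, hφ⟩ := exists_separated_form_of_filtration (0 : Fin 4) F
      hmono (N := fun n => 8 * n + 5) (by norm_num) (fun a b h => by simp only; omega) hF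
      (taylorCoeff u) hcoeff k
    refine ⟨⟨v, φ, hdeg, hφ⟩, fun μ _ => ?_⟩
    exact exists_memLp_separationRank_le (K := paramCube) isCompact_Icc (taylorPartialSum u k)
      v φ hφ μ
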